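/- Let $\mathcal T>0$, $|v|$ the Euclidean norm on $\mathbb R^3$, $L^1_2=L^1(\mathbb R^3;(1+|v|^2)\,dv)$. For a velocity distribution $g=g(v)$ put $$\rho_g=\int_{\mathbb R^3} g\,dv,\qquad u_g=\frac1{\rho_g}\int_{\mathbb R^3} v\,g\,dv,\qquad T_g=\frac1{3\rho_g}\int_{\mathbb R^3}|v-u_g|^2 g\,dv,\qquad \mathcal M[g](v)=\frac{\rho_g}{(2\pi T_g)^{3/2}}\,e^{-|v-u_g|^2/(2T_g)} ;$$ for $f=f(t,x,v)$ these are taken at each $(t,x)$. **Ansatz space.** Let $M=(C_{\rho,\min},C_{\rho,\max},C_{u,\max},C_{T,\min},C_{T,\max},C_\infty)$ be positive constants. $\mathcal X_M$ (on $[0,\mathcal T]\times[0,1]^3\times\mathbb R^3$) is the set of non-negative $f\in C^1\big([0,\mathcal T]\times[0,1]^3;\,L^1_2(\mathbb R^3_v)\cap L^2(\mathbb R^3_v)\big)$ with $C_{\rho,\min}\le\rho_f\le C_{\rho,\max}$, $C_{T,\min}\le T_f\le C_{T,\max}$, $|u_f|\le C_{u,\max}$ for all $(t,x)$, and $\operatorname{ess\,sup}_{t,x}\|f(t,x,\cdot)\|_{L^2_v}\le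 C_\infty$. **Exact solution and residuals.** $f$ is an exact solution (Knudsen number $1$, initial datum $f_0$) if $$\partial_t f+v\cdot\nabla_x f=\mathcal M[f]-f\ \text{ in }(0,\mathcal T)\times(0,1)^3\times\mathbb R^3,\qquad f(0,x,v)=f_0(x,v)\ \text{ on }[0,1]^3\times\mathbb R^3,$$ and $f(t,x|_{x_i=1},v)=f(t,x|_{x_i=0},v)$ for $i=1,2,3$ and $t\in[0,\mathcal T]$ (equalities for almost every $v$). For an approximate solution $\tilde f$, which need not satisfy any of these equations, put $$Res_{pde}=\partial_t\tilde f+v\cdot\nabla_x\tilde f-(\mathcal M[\tilde f]-\tilde f),\qquad Res_{ini}=\tilde f(0,x,v)-f_0(x,v),\qquad Res_{bc,i}=\tilde f(t,x|_{x_i=1},v)-\tilde f(t,x|_{x_i=0},v).$$ **The constant $c_M$.** There are $c_M,L_M>0$, depending only on $M$, such that for every $\mathcal T>0$, all $f,\tilde f\in\mathcal X_M$ and all $(t,x,v)\in[0,\mathcal T]\times[0,1]^3\times\mathbb R^3$, $$|\mathcal M[f](t,x,v)-\mathcal M[\tilde f](t,x,v)|\le L_M\,e^{-c_M|v|^2}\int_{\mathbb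 R^3}(1+|v_*|^2)\,|f(t,x,v_*)-\tilde f(t,x,v_*)|\,dv_*.\qquad(\ast)$$ **Theorem (Stability Estimate).** Such constants $c_M,L_M$ exist. Moreover, let $c_M>0$ be any constant for which $(\ast)$ holds with some $L_M>0$, let $\mathcal T>0$, and let $w:\mathbb R^3\to[1,\infty)$ be measurable with $$\int_{\mathbb R^3}\frac{(1+|v|^2)^2}{w(v)^2}\,dv<\infty,\qquad \int_{\mathbb R^3}w(v)^2e^{-2c_M|v|^2}\,dv<\infty .$$ Then there is a constant $C_*>0$ depending only on $\mathcal T$, $M$ and $w$ such that for every $f_0$, every exact solution $f\in\mathcal X_M$ with initial datum $f_0$, every $\tilde f\in\mathcal X_M$ and every $t\in[0,\mathcal T]$, $$\|w(f-\tilde f)(t)\|_2^2\le C_*\Big(\|w\,Res_{ini}\|_2^2+\int_0^t\|w\,Res_{pde}(s)\|_2^2\,ds+\sum_{i=1}^3\Big(\int_0^t\|v_i\,w^2\,Res_{bc,i}(s)\|_{\partial_i}^2\,ds\Big)^{1/2}\Big).$$ Here $\|\cdot\|_2$ is the norm of $L^2([0,1]^3\times\mathbb R^3)$ and $\|\cdot\|_{\partial_i}$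 that of $L^2([0,1]^2\times\mathbb R^3)$, in the two position variables other than $x_i$ and in $v$. All norms may take the value $+\infty$; in particular the left side is finite whenever the right side is. -/

import Mathlib

open MeasureTheory Set
open scoped ENNReal

noncomputable section

namespace BGK

/-- Positions; the spatial domain is the cube `Icc 0 1`, i.e. `[0,1]³`. -/
abbrev Pos := Fin 3 → ℝ

/-- Velocities, `ℝ³` with the Euclidean norm. -/
abbrev Vel := EuclideanSpace ℝ (Fin 3)

/-- The measure `(1 + |v|²) dv` on velocity space. -/
def weightedVolume : Measure Vel :=
  (volume : Measure Vel).withDensity fun v => ENNReal.ofReal (1 + ‖v‖ ^ 2)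

lemma volume_ac : (volume : Measure Vel) ≪ weightedVolume := by
  apply withDensity_absolutelyContinuous'
  · fun_prop
  · filter_upwards with v
    have : (0 : ℝ) < 1 + ‖v‖ ^ 2 := by positivity
    simpa using this

/-- The Banach space `L¹₂(ℝ³) ∩ L²(ℝ³)`, where `L¹₂ = L¹((1 + |v|²) dv)`: the pairs of a class in
`L¹₂` and a class in `L²` that are given by the same function. It carries the norm
`max ‖g‖_{L¹₂} ‖g‖_{L²}`, which is equivalent to the sum of the two norms. -/
def VSpace : Submodule ℝ (Lp ℝ 1 weightedVolume × Lp ℝ 2 (volume : Measure Vel)) where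
  carrier := {p | (p.1 : Vel → ℝ) =ᵐ[volume] (p.2 : Vel → ℝ)}
  add_mem' := by
    intro a b ha hb
    have h1 := volume_ac.ae_le (Lp.coeFn_add a.1 b.1)
    have h2 := Lp.coeFn_add a.2 b.2
    simp only [Set.mem_ofPred_eq] at ha hb ⊢
    filter_upwards [ha, hb, h1, h2] with v e1 e2 e3 e4
    simp only [Prod.fst_add, Prod.snd_add]
    rw [e3, e4, Pi.add_apply, Pi.add_apply, e1, e2]
  zero_mem' := by
    have h1 := volume_ac.ae_le (Lp.coeFn_zero ℝ 1 weightedVolume)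
    have h2 := Lp.coeFn_zero ℝ 2 (volume : Measure Vel)
    simp only [Set.mem_ofPred_eq]
    filter_upwards [h1, h2] with v e1 e2
    simp only [Prod.fst_zero, Prod.snd_zero]
    rw [e1, e2, Pi.zero_apply]
  smul_mem' := by
    intro c a ha
    have h1 := volume_ac.ae_le (Lp.coeFn_smul c a.1)
    have h2 := Lp.coeFn_smul c a.2
    simp only [Set.mem_ofPred_eq] at ha ⊢
    filter_upwards [ha, h1, h2] with v e1 e2 e3
    simp only [Prod.smul_fst, Prod.smul_snd]
    rw [e2, e3, Pi.smul_apply, Pi.smul_apply, e1]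

/-- The function of `v` (up to null sets) given by an element of `L¹₂ ∩ L²`. -/
instance : CoeFun VSpace (fun _ => Vel → ℝ) := ⟨fun g => (g.1.2 : Vel → ℝ)⟩

/-- The `L²(dv)` norm of an element of `L¹₂ ∩ L²`. -/
def l2norm (g : VSpace) : ℝ := ‖g.1.2‖

/-! ### Macroscopic moments and the local Maxwellian -/

/-- Mass `ρ = ∫ g dv`. -/
def density (g : VSpace) : ℝ := ∫ v, g v

/-- Bulk velocity `u = ρ⁻¹ ∫ v g dv`. -/
def bulkVelocity (g : VSpace) : Vel := (1 / density g) • ∫ v, g v • v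

/-- Temperature `T = (3ρ)⁻¹ ∫ |v - u|² g dv`. -/
def temperature (g : VSpace) : ℝ :=
  1 / (3 * density g) * ∫ v, ‖v - bulkVelocity g‖ ^ 2 * g v

/-- The Maxwellian with parameters `(ρ, u, T)`. -/
def maxwellian (ρ : ℝ) (u : Vel) (T : ℝ) (v : Vel) : ℝ :=
  ρ / (2 * Real.pi * T) ^ (3 / 2 : ℝ) * Real.exp (-‖v - u‖ ^ 2 / (2 * T))

/-- The local Maxwellian of `g`. -/
def localMaxwellian (g : VSpace) : Vel → ℝ :=
  maxwellian (density g) (bulkVelocity g) (temperature g)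

/-! ### The ansatz space -/

/-- The positive structural constants. -/
structure StructuralConstants where
  ρmin : ℝ
  ρmax : ℝ
  umax : ℝ
  Tmin : ℝ
  Tmax : ℝ
  Cinf : ℝ
  ρmin_pos : 0 < ρmin
  ρmax_pos : 0 < ρmax
  umax_pos : 0 < umax
  Tmin_pos : 0 < Tmin
  Tmax_pos : 0 < Tmax
  Cinf_pos : 0 < Cinf

/-- The space-time cylinder `[0,τ] × [0,1]³`. -/
def cylinder (τ : ℝ) : Set (ℝ × Pos) := Icc 0 τ ×ˢ Icc 0 1

/-- The ansatz space `X_M` on `[0,τ] × [0,1]³ × ℝ³`. -/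
structure AnsatzSpace (M : StructuralConstants) (τ : ℝ) (f : ℝ × Pos → VSpace) : Prop where
  contDiffOn : ContDiffOn ℝ 1 f (cylinder τ)
  nonneg : ∀ p ∈ cylinder τ, ∀ᵐ v : Vel, 0 ≤ f p v
  le_density : ∀ p ∈ cylinder τ, M.ρmin ≤ density (f p)
  density_le : ∀ p ∈ cylinder τ, density (f p) ≤ M.ρmax
  le_temperature : ∀ p ∈ cylinder τ, M.Tmin ≤ temperature (f p)
  temperature_le : ∀ p ∈ cylinder τ, temperature (f p) ≤ M.Tmax
  bulkVelocity_le : ∀ p ∈ cylinder τ, ‖bulkVelocity (f p)‖ ≤ M.umax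
  /-- `ess sup_{t,x} ‖f(t,x)‖_{L²_v} ≤ C_∞` -/
  l2norm_le : ∀ᵐ p ∂(volume.restrict (cylinder τ)), l2norm (f p) ≤ M.Cinf

/-! ### The BGK problem and the residuals -/

/-- `∂ₜ f + v · ∇ₓ f` at `p = (t,x)`, as a function of `v`; the derivatives are those of
`f : [0,τ] × [0,1]³ → L¹₂ ∩ L²` (one-sided at the boundary of the cylinder). -/
def transport (τ : ℝ) (f : ℝ × Pos → VSpace) (p : ℝ × Pos) (v : Vel) : ℝ :=
  (fderivWithin ℝ f (cylinder τ) p (1, 0)) v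
    + ∑ i : Fin 3, v i * (fderivWithin ℝ f (cylinder τ) p (0, Pi.single i 1)) v

/-- `f` solves the periodic BGK problem with Knudsen number one and initial datum `f₀`. -/
structure IsBGKSolution (τ : ℝ) (f₀ : Pos → Vel → ℝ) (f : ℝ × Pos → VSpace) : Prop where
  equation : ∀ t ∈ Ioo 0 τ, ∀ x : Pos, (∀ i, x i ∈ Ioo (0 : ℝ) 1) →
    ∀ᵐ v : Vel, transport τ f (t, x) v = localMaxwellian (f (t, x)) v - f (t, x) v
  initial : ∀ x ∈ Icc (0 : Pos) 1, ∀ᵐ v : Vel, f (0, x) v = f₀ x v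
  periodic : ∀ t ∈ Icc 0 τ, ∀ i : Fin 3, ∀ y ∈ Icc (0 : Fin 2 → ℝ) 1,
    f (t, i.insertNth 1 y) = f (t, i.insertNth 0 y)

/-- The residual of the equation. -/
def resPde (τ : ℝ) (g : ℝ × Pos → VSpace) (t : ℝ) (x : Pos) (v : Vel) : ℝ :=
  transport τ g (t, x) v - (localMaxwellian (g (t, x)) v - g (t, x) v)

/-- The residual of the initial condition. -/
def resIni (f₀ : Pos → Vel → ℝ) (g : ℝ × Pos → VSpace) (x : Pos) (v : Vel) : ℝ :=
  g (0, x) v - f₀ x v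

/-- The residual of the boundary condition on the pair of faces `xᵢ = 0`, `xᵢ = 1`;
`y` are the two remaining coordinates. -/
def resBc (g : ℝ × Pos → VSpace) (i : Fin 3) (t : ℝ) (y : Fin 2 → ℝ) (v : Vel) : ℝ :=
  g (t, i.insertNth 1 y) v - g (t, i.insertNth 0 y) v

/-! ### Norms, with values in `[0,∞]` -/

/-- `‖h‖₂²`, the squared norm of `L²([0,1]³ × ℝ³)`. -/
def normSq (h : Pos → Vel → ℝ) : ℝ≥0∞ :=
  ∫⁻ x in Icc (0 : Pos) 1, ∫⁻ v : Vel, ENNReal.ofReal (h x v ^ 2)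

/-- The squared norm of `L²([0,1]² × ℝ³)`, on a face of the cube. -/
def faceNormSq (h : (Fin 2 → ℝ) → Vel → ℝ) : ℝ≥0∞ :=
  ∫⁻ y in Icc (0 : Fin 2 → ℝ) 1, ∫⁻ v : Vel, ENNReal.ofReal (h y v ^ 2)

/-- `c` and `L` are constants in the Lipschitz-type estimate
`|M[f] - M[g]|(t,x,v) ≤ L e^{-c|v|²} ∫ (1 + |v'|²) |f - g|(t,x,v') dv'`
for the local Maxwellian, uniformly over the ansatz space `X_M` (for every final time). -/
def IsMaxwellianLipschitz (M : StructuralConstants) (c L : ℝ) : Prop :=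
  ∀ τ : ℝ, 0 < τ → ∀ f g : ℝ × Pos → VSpace, AnsatzSpace M τ f → AnsatzSpace M τ g →
    ∀ p ∈ cylinder τ, ∀ v : Vel,
      |localMaxwellian (f p) v - localMaxwellian (g p) v| ≤
        L * Real.exp (-c * ‖v‖ ^ 2) * ∫ v' : Vel, (1 + ‖v'‖ ^ 2) * |f p v' - g p v'|

end BGK

end

/-!
# Stability of the BGK equation in a weighted `L²` norm

The Lipschitz estimate for the Maxwellian follows from writing it as the exponential of
`log ρ - (3/2) log (2πT) - |v - u|²/(2T)`: this exponent is Lipschitz in `(ρ, u, T)` with a constant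
growing like `1 + |v|²` (`abs_maxwellianExponent_sub_le`), the growth is absorbed by half of the
Gaussian, and the moments are Lipschitz in `L¹₂` (`exists_parameters_sub_le`).

For the stability estimate let `h = f - g` and let `θ` be a bounded truncation of `w²`. Then
`Φ = ∫ θ h² dv` and `Ψᵢ = ∫ vᵢ θ h² dv` are real `C¹` functions of `(t, x)` with
`∂ₜΦ + ∑ᵢ ∂ᵢΨᵢ = 2 ∫ θ h (∂ₜh + v · ∇ₓh) dv`. Since `∂ₜh + v · ∇ₓh = (M[f] - M[g]) - h - Res`, the
damping `-h` absorbs both cross terms and the right side is at most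
`∫ θ (M[f] - M[g])² dv + ∫ θ Res² dv` (`ofReal_production_le`). By periodicity of `f`, the jump of
`h²` between opposite faces is a sum of traces, bounded in `L²` by `4 C_∞`, times the boundary
residual (`ofReal_abs_velQuad_sub_sq_le`). The fundamental theorem of calculus in time and the
divergence theorem on the cube (`ofReal_setIntegral_le_of_balance`), followed by monotone
convergence in the truncation, give
`‖w h(t)‖² ≤ E + κ ∫₀ᵗ A(s) ds` (`normSq_le_add_lintegral`), where `E` collects the residuals and
`A(s) = ∫ ‖h(s, x)‖²_{L¹₂} dx`.

The weighted norm of `h` might be infinite, but `A` is a continuous real function, and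
`A ≤ κ₁ ‖w h‖²` by Cauchy–Schwarz. Grönwall's inequality is therefore run on `A`
(`le_exp_mul_of_le_add_lintegral`), which also yields finiteness of the weighted norm.
-/

namespace BGK

/-! ### Integrability and moments of elements of `L¹₂ ∩ L²` -/

lemma integrable_weightedVolume_iff {φ : Vel → ℝ} :
    Integrable φ weightedVolume ↔ Integrable (fun v : Vel => (1 + ‖v‖ ^ 2) * φ v) := by
  have hm : Measurable fun v : Vel => ENNReal.ofReal (1 + ‖v‖ ^ 2) := by fun_prop
  rw [weightedVolume, integrable_withDensity_iff_integrable_smul' hm (by simp)]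
  refine integrable_congr (.of_forall fun v => ?_)
  simp only [smul_eq_mul]
  rw [ENNReal.toReal_ofReal (by positivity)]

lemma integral_weightedVolume (φ : Vel → ℝ) :
    ∫ v, φ v ∂weightedVolume = ∫ v : Vel, (1 + ‖v‖ ^ 2) * φ v := by
  have hm : Measurable fun v : Vel => ENNReal.ofReal (1 + ‖v‖ ^ 2) := by fun_prop
  rw [weightedVolume, integral_withDensity_eq_integral_toReal_smul hm (by simp)]
  refine integral_congr_ae (.of_forall fun v => ?_)
  simp only [smul_eq_mul]
  rw [ENNReal.toReal_ofReal (by positivity)]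

lemma fst_ae_eq (g : VSpace) : (g.1.1 : Vel → ℝ) =ᵐ[volume] (g : Vel → ℝ) := g.2

lemma integrable_weight_mul (g : VSpace) :
    Integrable (fun v : Vel => (1 + ‖v‖ ^ 2) * g v) := by
  refine (integrable_weightedVolume_iff.1 (L1.integrable_coeFn g.1.1)).congr ?_
  filter_upwards [fst_ae_eq g] with v hv
  rw [hv]

/-- The norm of the `L¹₂` component, as an integral against Lebesgue measure. -/
lemma norm_fst_eq (g : VSpace) : ‖g.1.1‖ = ∫ v : Vel, (1 + ‖v‖ ^ 2) * |g v| := by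
  rw [L1.norm_eq_integral_norm, integral_weightedVolume]
  refine integral_congr_ae ?_
  filter_upwards [fst_ae_eq g] with v hv
  rw [hv, Real.norm_eq_abs]

lemma coeFn_sub (f g : VSpace) : (f - g : VSpace) =ᵐ[volume] fun v => f v - g v :=
  Lp.coeFn_sub f.1.2 g.1.2

lemma aestronglyMeasurable_coeFn (g : VSpace) : AEStronglyMeasurable (g : Vel → ℝ) volume :=
  Lp.aestronglyMeasurable g.1.2

lemma integrable_smul_of_norm_le {E : Type*} [NormedAddCommGroup E] [NormedSpace ℝ E]
    [SecondCountableTopology E] (g : VSpace) {φ : Vel → E} (hφ : Continuous φ)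
    (hb : ∀ v, ‖φ v‖ ≤ 1 + ‖v‖ ^ 2) : Integrable (fun v : Vel => g v • φ v) := by
  refine (integrable_weight_mul g).mono
    ((aestronglyMeasurable_coeFn g).smul hφ.aestronglyMeasurable) (.of_forall fun v => ?_)
  have h0 : 0 ≤ 1 + ‖v‖ ^ 2 := by positivity
  rw [norm_smul, norm_mul, mul_comm, Real.norm_of_nonneg h0]
  exact mul_le_mul_of_nonneg_right (hb v) (norm_nonneg _)

/-- The distance of `f` and `g` in `L¹₂`. -/
noncomputable def weightedDist (f g : VSpace) : ℝ := ∫ v : Vel, (1 + ‖v‖ ^ 2) * |f v - g v|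

lemma norm_fst_sub_eq (f g : VSpace) : ‖(f - g).1.1‖ = weightedDist f g := by
  rw [norm_fst_eq]
  refine integral_congr_ae ?_
  filter_upwards [coeFn_sub f g] with v hv
  rw [hv]

lemma weightedDist_nonneg (f g : VSpace) : 0 ≤ weightedDist f g := by
  rw [← norm_fst_sub_eq]; exact norm_nonneg _

/-- Moments of order at most two are `1`-Lipschitz for the `L¹₂` distance. -/
lemma norm_moment_sub_le {E : Type*} [NormedAddCommGroup E] [NormedSpace ℝ E]
    [SecondCountableTopology E] (f g : VSpace) {φ : Vel → E} (hφ : Continuous φ)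
    (hb : ∀ v, ‖φ v‖ ≤ 1 + ‖v‖ ^ 2) :
    ‖(∫ v, f v • φ v) - ∫ v, g v • φ v‖ ≤ weightedDist f g := by
  rw [← integral_sub (integrable_smul_of_norm_le f hφ hb) (integrable_smul_of_norm_le g hφ hb)]
  refine norm_integral_le_of_norm_le ?_ (.of_forall fun v => ?_)
  · refine (integrable_weight_mul (f - g)).norm.congr ?_
    filter_upwards [coeFn_sub f g] with v hv
    have h0 : 0 ≤ 1 + ‖v‖ ^ 2 := by positivity
    rw [hv, norm_mul, Real.norm_of_nonneg h0, Real.norm_eq_abs]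
  · rw [← sub_smul, norm_smul, mul_comm, Real.norm_eq_abs]
    exact mul_le_mul_of_nonneg_right (hb v) (abs_nonneg _)

/-- The energy `∫ |v|² g dv`. -/
noncomputable def energy (g : VSpace) : ℝ := ∫ v, g v • ‖v‖ ^ 2

lemma norm_le_one_add_sq (v : Vel) : ‖v‖ ≤ 1 + ‖v‖ ^ 2 := by nlinarith [sq_nonneg (‖v‖ - 1)]

lemma norm_sq_le_one_add_sq (v : Vel) : ‖(‖v‖ ^ 2 : ℝ)‖ ≤ 1 + ‖v‖ ^ 2 := by
  rw [Real.norm_of_nonneg (by positivity)]; linarith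

lemma norm_one_le_one_add_sq (v : Vel) : ‖(1 : ℝ)‖ ≤ 1 + ‖v‖ ^ 2 := by
  rw [norm_one]; nlinarith [sq_nonneg ‖v‖]

lemma abs_density_sub_le (f g : VSpace) : |density f - density g| ≤ weightedDist f g := by
  have := norm_moment_sub_le f g (φ := fun _ => (1 : ℝ)) continuous_const norm_one_le_one_add_sq
  simpa [density] using this

lemma abs_energy_sub_le (f g : VSpace) : |energy f - energy g| ≤ weightedDist f g :=
  norm_moment_sub_le f g (φ := fun v => ‖v‖ ^ 2) (by fun_prop) norm_sq_le_one_add_sq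

lemma norm_momentum_sub_le (f g : VSpace) :
    ‖(∫ v, f v • v) - ∫ v, g v • v‖ ≤ weightedDist f g :=
  norm_moment_sub_le f g (φ := fun v => v) continuous_id norm_le_one_add_sq

lemma density_smul_bulkVelocity {g : VSpace} (hg : density g ≠ 0) :
    density g • bulkVelocity g = ∫ v, g v • v := by
  rw [bulkVelocity, smul_smul, mul_one_div_cancel hg, one_smul]

lemma temperature_eq {g : VSpace} (hg : density g ≠ 0) :
    temperature g = energy g / (3 * density g) - ‖bulkVelocity g‖ ^ 2 / 3 := by
  set u := bulkVelocity g with hu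
  have i0 : Integrable fun v => g v := by
    simpa using integrable_smul_of_norm_le g (φ := fun _ => (1 : ℝ)) continuous_const
      norm_one_le_one_add_sq
  have i1 : Integrable fun v => g v • v :=
    integrable_smul_of_norm_le g (φ := fun v => v) continuous_id norm_le_one_add_sq
  have i2 : Integrable fun v => g v • ‖v‖ ^ 2 :=
    integrable_smul_of_norm_le g (φ := fun v => ‖v‖ ^ 2) (by fun_prop) norm_sq_le_one_add_sq
  have i1' : Integrable fun v => inner ℝ u (g v • v) := i1.const_inner u
  have e1 : ∫ v, inner ℝ u (g v • v) = density g * ‖u‖ ^ 2 := by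
    rw [integral_inner i1, ← density_smul_bulkVelocity hg, inner_smul_right,
      real_inner_self_eq_norm_sq]
  have e2 : ∫ v, ‖v - u‖ ^ 2 * g v
      = ∫ v, (g v • ‖v‖ ^ 2 - 2 * inner ℝ u (g v • v) + ‖u‖ ^ 2 * g v) := by
    refine integral_congr_ae (.of_forall fun v => ?_)
    simp only [norm_sub_sq_real, inner_smul_right, smul_eq_mul, real_inner_comm u v]
    ring
  have e3 : ∫ v, ‖v - u‖ ^ 2 * g v = energy g - density g * ‖u‖ ^ 2 := by
    rw [e2, integral_add (f := fun v => g v • ‖v‖ ^ 2 - 2 * inner ℝ u (g v • v))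
        (i2.sub (i1'.const_mul 2)) (i0.const_mul _),
      integral_sub i2 (i1'.const_mul 2), integral_const_mul, integral_const_mul, e1]
    simp only [energy, density]
    ring
  rw [temperature, ← hu, e3]
  field_simp

/-! ### Lipschitz estimate for the Maxwellian -/

/-- The parameters of a Maxwellian lie within the bounds prescribed by `M`. -/
structure Admissible (M : StructuralConstants) (ρ : ℝ) (u : Vel) (T : ℝ) : Prop where
  le_ρ : M.ρmin ≤ ρ
  ρ_le : ρ ≤ M.ρmax
  u_le : ‖u‖ ≤ M.umax
  le_T : M.Tmin ≤ T
  T_le : T ≤ M.Tmax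

lemma Admissible.ρ_pos {M ρ u T} (h : Admissible M ρ u T) : 0 < ρ := M.ρmin_pos.trans_le h.le_ρ
lemma Admissible.T_pos {M ρ u T} (h : Admissible M ρ u T) : 0 < T := M.Tmin_pos.trans_le h.le_T

lemma AnsatzSpace.admissible {M τ f} (hf : AnsatzSpace M τ f) {p} (hp : p ∈ cylinder τ) :
    Admissible M (density (f p)) (bulkVelocity (f p)) (temperature (f p)) :=
  ⟨hf.le_density p hp, hf.density_le p hp, hf.bulkVelocity_le p hp, hf.le_temperature p hp,
    hf.temperature_le p hp⟩

/-- The exponent of a Maxwellian, once its prefactor is absorbed in the exponential. -/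
noncomputable def maxwellianExponent (ρ : ℝ) (u : Vel) (T : ℝ) (v : Vel) : ℝ :=
  Real.log ρ - 3 / 2 * Real.log (2 * Real.pi * T) - ‖v - u‖ ^ 2 / (2 * T)

lemma maxwellian_eq_exp {ρ T : ℝ} (hρ : 0 < ρ) (hT : 0 < T) (u v : Vel) :
    maxwellian ρ u T v = Real.exp (maxwellianExponent ρ u T v) := by
  have h2 : 0 < 2 * Real.pi * T := by positivity
  rw [maxwellian, maxwellianExponent, Real.exp_sub, Real.exp_sub, Real.exp_log hρ,
    Real.rpow_def_of_pos h2, mul_comm (3 / 2 : ℝ), neg_div, Real.exp_neg]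
  rfl

lemma abs_log_sub_log_le {m a b : ℝ} (hm : 0 < m) (ha : m ≤ a) (hb : m ≤ b) :
    |Real.log a - Real.log b| ≤ |a - b| / m := by
  have key : ∀ a b : ℝ, m ≤ a → m ≤ b → Real.log a - Real.log b ≤ |a - b| / m := by
    intro a b ha hb
    have ha0 := hm.trans_le ha
    have hb0 := hm.trans_le hb
    calc Real.log a - Real.log b = Real.log (a / b) := (Real.log_div ha0.ne' hb0.ne').symm
      _ ≤ a / b - 1 := Real.log_le_sub_one_of_pos (by positivity)
      _ = (a - b) / b := by field_simp
      _ ≤ |a - b| / b := by gcongr; exact le_abs_self _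
      _ ≤ |a - b| / m := by gcongr
  refine abs_le'.2 ⟨key a b ha hb, ?_⟩
  rw [neg_sub, abs_sub_comm]
  exact key b a hb ha

lemma abs_exp_sub_exp_le (a b : ℝ) :
    |Real.exp a - Real.exp b| ≤ |a - b| * (Real.exp a + Real.exp b) := by
  have key : ∀ a b : ℝ, Real.exp a - Real.exp b ≤ |a - b| * (Real.exp a + Real.exp b) := by
    intro a b
    have h1 : Real.exp b = Real.exp a * Real.exp (b - a) := by
      rw [← Real.exp_add]; ring_nf
    have h2 := Real.add_one_le_exp (b - a)
    have h3 := le_abs_self (a - b)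
    have h4 := Real.exp_pos a
    have h5 := mul_nonneg (abs_nonneg (a - b)) (Real.exp_pos b).le
    nlinarith
  refine abs_le'.2 ⟨key a b, ?_⟩
  rw [neg_sub, abs_sub_comm, add_comm (Real.exp a)]
  exact key b a

lemma norm_sub_sq_le {M ρ u T} (h : Admissible M ρ u T) (v : Vel) :
    ‖v - u‖ ^ 2 ≤ 2 * (1 + M.umax ^ 2) * (1 + ‖v‖ ^ 2) := by
  have h1 : ‖v - u‖ ≤ ‖v‖ + M.umax := (norm_sub_le v u).trans (by linarith [h.u_le])
  have h2 : ‖v - u‖ ^ 2 ≤ (‖v‖ + M.umax) ^ 2 := by gcongr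
  nlinarith [sq_nonneg (‖v‖ - M.umax), mul_nonneg (sq_nonneg ‖v‖) (sq_nonneg M.umax)]

lemma abs_maxwellianExponent_sub_le {M : StructuralConstants} {ρ₁ ρ₂ T₁ T₂ : ℝ} {u₁ u₂ : Vel}
    (h₁ : Admissible M ρ₁ u₁ T₁) (h₂ : Admissible M ρ₂ u₂ T₂) (v : Vel) :
    |maxwellianExponent ρ₁ u₁ T₁ v - maxwellianExponent ρ₂ u₂ T₂ v| ≤
      (1 / M.ρmin + (1 + M.umax) / M.Tmin + (3 / (2 * M.Tmin) + (1 + M.umax ^ 2) / M.Tmin ^ 2))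
        * (1 + ‖v‖ ^ 2) * (|ρ₁ - ρ₂| + ‖u₁ - u₂‖ + |T₁ - T₂|) := by
  have hρm := M.ρmin_pos
  have hTm := M.Tmin_pos
  have hU := M.umax_pos
  have hT₁ := h₁.T_pos
  have hT₂ := h₂.T_pos
  set q : ℝ := 1 + ‖v‖ ^ 2 with hq
  have hq1 : 1 ≤ q := by rw [hq]; nlinarith [sq_nonneg ‖v‖]
  have a1 : |Real.log ρ₁ - Real.log ρ₂| ≤ 1 / M.ρmin * q * |ρ₁ - ρ₂| := by
    refine (abs_log_sub_log_le hρm h₁.le_ρ h₂.le_ρ).trans ?_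
    rw [div_eq_mul_one_div, mul_comm, mul_right_comm]
    exact le_mul_of_one_le_right (by positivity) hq1
  have a2 : |3 / 2 * (Real.log (2 * Real.pi * T₁) - Real.log (2 * Real.pi * T₂))|
      ≤ 3 / (2 * M.Tmin) * q * |T₁ - T₂| := by
    rw [Real.log_mul (by positivity) hT₁.ne', Real.log_mul (by positivity) hT₂.ne',
      add_sub_add_left_eq_sub, abs_mul, abs_of_pos (by norm_num : (0 : ℝ) < 3 / 2)]
    refine (mul_le_mul_of_nonneg_left (abs_log_sub_log_le hTm h₁.le_T h₂.le_T)
      (by norm_num)).trans ?_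
    rw [show 3 / 2 * (|T₁ - T₂| / M.Tmin) = 3 / (2 * M.Tmin) * |T₁ - T₂| by field_simp,
      mul_right_comm]
    exact le_mul_of_one_le_right (by positivity) hq1
  have a3 : |(‖v - u₁‖ ^ 2 - ‖v - u₂‖ ^ 2) / (2 * T₁)|
      ≤ (1 + M.umax) / M.Tmin * q * ‖u₁ - u₂‖ := by
    have b1 : |‖v - u₁‖ - ‖v - u₂‖| ≤ ‖u₁ - u₂‖ := by
      refine (abs_norm_sub_norm_le _ _).trans_eq ?_
      rw [sub_sub_sub_cancel_left, norm_sub_rev]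
    have b2 : ‖v - u₁‖ + ‖v - u₂‖ ≤ 2 * ((1 + M.umax) * q) := by
      have c1 := norm_sub_le v u₁
      have c2 := norm_sub_le v u₂
      have c3 := norm_le_one_add_sq v
      nlinarith [h₁.u_le, h₂.u_le]
    rw [abs_div, abs_of_pos (by positivity : 0 < 2 * T₁), sq_sub_sq, abs_mul,
      abs_of_nonneg (by positivity : 0 ≤ ‖v - u₁‖ + ‖v - u₂‖)]
    calc (‖v - u₁‖ + ‖v - u₂‖) * |‖v - u₁‖ - ‖v - u₂‖| / (2 * T₁)
        ≤ 2 * ((1 + M.umax) * q) * ‖u₁ - u₂‖ / (2 * M.Tmin) := by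
          gcongr
          exact h₁.le_T
      _ = (1 + M.umax) / M.Tmin * q * ‖u₁ - u₂‖ := by field_simp
  have a4 : |‖v - u₂‖ ^ 2 * (1 / (2 * T₁) - 1 / (2 * T₂))|
      ≤ (1 + M.umax ^ 2) / M.Tmin ^ 2 * q * |T₁ - T₂| := by
    have b1 : 1 / (2 * T₁) - 1 / (2 * T₂) = (T₂ - T₁) / (2 * (T₁ * T₂)) := by field_simp
    have b2 : M.Tmin ^ 2 ≤ T₁ * T₂ := by
      rw [sq]; exact mul_le_mul h₁.le_T h₂.le_T hTm.le hT₁.le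
    rw [b1, abs_mul, abs_div, abs_of_pos (by positivity : 0 < 2 * (T₁ * T₂)), abs_sub_comm T₂,
      abs_of_nonneg (sq_nonneg ‖v - u₂‖)]
    calc ‖v - u₂‖ ^ 2 * (|T₁ - T₂| / (2 * (T₁ * T₂)))
        ≤ 2 * (1 + M.umax ^ 2) * q * (|T₁ - T₂| / (2 * M.Tmin ^ 2)) := by
          gcongr
          exact norm_sub_sq_le h₂ v
      _ = (1 + M.umax ^ 2) / M.Tmin ^ 2 * q * |T₁ - T₂| := by field_simp
  have e : maxwellianExponent ρ₁ u₁ T₁ v - maxwellianExponent ρ₂ u₂ T₂ v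
      = (Real.log ρ₁ - Real.log ρ₂)
        - 3 / 2 * (Real.log (2 * Real.pi * T₁) - Real.log (2 * Real.pi * T₂))
        - (‖v - u₁‖ ^ 2 - ‖v - u₂‖ ^ 2) / (2 * T₁)
        - ‖v - u₂‖ ^ 2 * (1 / (2 * T₁) - 1 / (2 * T₂)) := by
    simp only [maxwellianExponent]; ring
  set kρ := 1 / M.ρmin
  set ku := (1 + M.umax) / M.Tmin
  set kT := 3 / (2 * M.Tmin)
  set kT' := (1 + M.umax ^ 2) / M.Tmin ^ 2
  have hkρ : 0 ≤ kρ := by positivity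
  have hku : 0 ≤ ku := by positivity
  have hkT : 0 ≤ kT := by positivity
  have hkT' : 0 ≤ kT' := by positivity
  rw [e]
  calc _ ≤ |Real.log ρ₁ - Real.log ρ₂|
        + |3 / 2 * (Real.log (2 * Real.pi * T₁) - Real.log (2 * Real.pi * T₂))|
        + |(‖v - u₁‖ ^ 2 - ‖v - u₂‖ ^ 2) / (2 * T₁)|
        + |‖v - u₂‖ ^ 2 * (1 / (2 * T₁) - 1 / (2 * T₂))| :=
      (abs_sub _ _).trans (add_le_add_left ((abs_sub _ _).trans
        (add_le_add_left (abs_sub _ _) _)) _)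
    _ ≤ kρ * q * |ρ₁ - ρ₂| + kT * q * |T₁ - T₂| + ku * q * ‖u₁ - u₂‖ + kT' * q * |T₁ - T₂| :=
      add_le_add (add_le_add (add_le_add a1 a2) a3) a4
    _ = q * (kρ * |ρ₁ - ρ₂| + ku * ‖u₁ - u₂‖ + (kT + kT') * |T₁ - T₂|) := by ring
    _ ≤ q * ((kρ + ku + (kT + kT')) * |ρ₁ - ρ₂| + (kρ + ku + (kT + kT')) * ‖u₁ - u₂‖
          + (kρ + ku + (kT + kT')) * |T₁ - T₂|) := by
      refine mul_le_mul_of_nonneg_left ?_ (by positivity)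
      refine add_le_add (add_le_add ?_ ?_) ?_ <;>
        exact mul_le_mul_of_nonneg_right (by linarith) (by positivity)
    _ = _ := by ring

lemma Admissible.maxwellian_le {M ρ u T} (h : Admissible M ρ u T) (v : Vel) :
    maxwellian ρ u T v ≤ M.ρmax / (2 * Real.pi * M.Tmin) ^ (3 / 2 : ℝ)
      * Real.exp (M.umax ^ 2 / (2 * M.Tmax)) * Real.exp (-‖v‖ ^ 2 / (4 * M.Tmax)) := by
  have hTm := M.Tmin_pos
  have hTM := M.Tmax_pos
  have hT := h.T_pos
  have hρ := M.ρmax_pos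
  rw [maxwellian, mul_assoc (M.ρmax / _), ← Real.exp_add]
  have h1 : -‖v - u‖ ^ 2 / (2 * T)
      ≤ M.umax ^ 2 / (2 * M.Tmax) + -‖v‖ ^ 2 / (4 * M.Tmax) := by
    have c1 : ‖v‖ ^ 2 / 2 - M.umax ^ 2 ≤ ‖v - u‖ ^ 2 := by
      have d1 : ‖v‖ ≤ ‖v - u‖ + M.umax := by
        linarith [norm_le_norm_sub_add v u, h.u_le]
      have d2 : ‖v‖ ^ 2 ≤ (‖v - u‖ + M.umax) ^ 2 := by gcongr
      nlinarith [sq_nonneg (‖v - u‖ - M.umax)]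
    have c2 : ‖v - u‖ ^ 2 / (2 * M.Tmax) ≤ ‖v - u‖ ^ 2 / (2 * T) := by
      gcongr
      exact h.T_le
    have c3 : (‖v‖ ^ 2 / 2 - M.umax ^ 2) / (2 * M.Tmax) ≤ ‖v - u‖ ^ 2 / (2 * M.Tmax) := by
      gcongr
    have c4 : (‖v‖ ^ 2 / 2 - M.umax ^ 2) / (2 * M.Tmax)
        = ‖v‖ ^ 2 / (4 * M.Tmax) - M.umax ^ 2 / (2 * M.Tmax) := by
      field_simp
      ring
    rw [neg_div, neg_div]
    linarith
  gcongr
  · exact h.ρ_le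
  · exact h.le_T

/-- The Maxwellian is Lipschitz in its parameters, with a Gaussian bound in the velocity: the
polynomial growth of the exponent is absorbed by half of the Gaussian. -/
lemma exists_abs_maxwellian_sub_le (M : StructuralConstants) :
    ∃ c L : ℝ, 0 < c ∧ 0 < L ∧ ∀ ρ₁ u₁ T₁ ρ₂ u₂ T₂, Admissible M ρ₁ u₁ T₁ →
      Admissible M ρ₂ u₂ T₂ → ∀ v, |maxwellian ρ₁ u₁ T₁ v - maxwellian ρ₂ u₂ T₂ v| ≤
        L * Real.exp (-c * ‖v‖ ^ 2) * (|ρ₁ - ρ₂| + ‖u₁ - u₂‖ + |T₁ - T₂|) := by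
  have hρm := M.ρmin_pos
  have hTm := M.Tmin_pos
  have hTM := M.Tmax_pos
  have hρM := M.ρmax_pos
  have hU := M.umax_pos
  have hb := fun ρ u T (h : Admissible M ρ u T) v => h.maxwellian_le v
  have hd := fun ρ₁ u₁ T₁ ρ₂ u₂ T₂ (h₁ : Admissible M ρ₁ u₁ T₁) (h₂ : Admissible M ρ₂ u₂ T₂) v =>
    abs_maxwellianExponent_sub_le h₁ h₂ v
  set G := M.ρmax / (2 * Real.pi * M.Tmin) ^ (3 / 2 : ℝ) * Real.exp (M.umax ^ 2 / (2 * M.Tmax))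
  set K := 1 / M.ρmin + (1 + M.umax) / M.Tmin
    + (3 / (2 * M.Tmin) + (1 + M.umax ^ 2) / M.Tmin ^ 2)
  have hG : 0 < G := by positivity
  have hK : 0 < K := by positivity
  refine ⟨1 / (8 * M.Tmax), 2 * K * G * (1 + 8 * M.Tmax), by positivity, by positivity, ?_⟩
  intro ρ₁ u₁ T₁ ρ₂ u₂ T₂ h₁ h₂ v
  set Δ := |ρ₁ - ρ₂| + ‖u₁ - u₂‖ + |T₁ - T₂|
  have hΔ : 0 ≤ Δ := by positivity
  have e1 : (1 + ‖v‖ ^ 2) ≤ (1 + 8 * M.Tmax) * Real.exp (‖v‖ ^ 2 / (8 * M.Tmax)) := by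
    have c1 := Real.add_one_le_exp (‖v‖ ^ 2 / (8 * M.Tmax))
    have c2 : (1 + 8 * M.Tmax) * (‖v‖ ^ 2 / (8 * M.Tmax) + 1)
        = ‖v‖ ^ 2 + 8 * M.Tmax + 1 + ‖v‖ ^ 2 / (8 * M.Tmax) := by field_simp; ring
    have c3 : 0 ≤ ‖v‖ ^ 2 / (8 * M.Tmax) := by positivity
    nlinarith [mul_le_mul_of_nonneg_left c1 (by positivity : 0 ≤ 1 + 8 * M.Tmax)]
  have e2 : Real.exp (‖v‖ ^ 2 / (8 * M.Tmax)) * Real.exp (-‖v‖ ^ 2 / (4 * M.Tmax))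
      = Real.exp (-(1 / (8 * M.Tmax)) * ‖v‖ ^ 2) := by
    rw [← Real.exp_add]; congr 1; field_simp; ring
  have g1 := hb _ _ _ h₁ v
  have g2 := hb _ _ _ h₂ v
  have g3 := hd _ _ _ _ _ _ h₁ h₂ v
  rw [maxwellian_eq_exp h₁.ρ_pos h₁.T_pos] at g1 ⊢
  rw [maxwellian_eq_exp h₂.ρ_pos h₂.T_pos] at g2 ⊢
  calc _ ≤ _ := abs_exp_sub_exp_le _ _
    _ ≤ K * (1 + ‖v‖ ^ 2) * Δ * (G * Real.exp (-‖v‖ ^ 2 / (4 * M.Tmax))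
        + G * Real.exp (-‖v‖ ^ 2 / (4 * M.Tmax))) := by gcongr
    _ = 2 * K * G * Δ * (1 + ‖v‖ ^ 2) * Real.exp (-‖v‖ ^ 2 / (4 * M.Tmax)) := by ring
    _ ≤ 2 * K * G * Δ * ((1 + 8 * M.Tmax) * Real.exp (‖v‖ ^ 2 / (8 * M.Tmax)))
        * Real.exp (-‖v‖ ^ 2 / (4 * M.Tmax)) := by gcongr
    _ = 2 * K * G * (1 + 8 * M.Tmax) * (Real.exp (‖v‖ ^ 2 / (8 * M.Tmax))
        * Real.exp (-‖v‖ ^ 2 / (4 * M.Tmax))) * Δ := by ring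
    _ = _ := by rw [e2]

/-- Density, bulk velocity and temperature are Lipschitz for the `L¹₂` distance. -/
lemma exists_parameters_sub_le (M : StructuralConstants) :
    ∃ K : ℝ, 0 < K ∧ ∀ f g : VSpace,
      Admissible M (density f) (bulkVelocity f) (temperature f) →
      Admissible M (density g) (bulkVelocity g) (temperature g) →
      |density f - density g| + ‖bulkVelocity f - bulkVelocity g‖
        + |temperature f - temperature g| ≤ K * weightedDist f g := by
  have hρm := M.ρmin_pos
  have hTM := M.Tmax_pos
  have hU := M.umax_pos
  have hρM := M.ρmax_pos
  set Ku := (1 + M.umax) / M.ρmin with hKu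
  set Ke := (1 + (3 * M.Tmax + M.umax ^ 2)) / M.ρmin with hKe
  have hKu0 : 0 < Ku := by positivity
  have hKe0 : 0 < Ke := by positivity
  refine ⟨1 + Ku + (Ke / 3 + 2 * M.umax * Ku / 3), by positivity, fun f g hf hg => ?_⟩
  set D := weightedDist f g
  have hD : 0 ≤ D := weightedDist_nonneg f g
  have hρf := hf.ρ_pos
  have hρg := hg.ρ_pos
  have d1 : |density f - density g| ≤ D := abs_density_sub_le f g
  have d2 : ‖bulkVelocity f - bulkVelocity g‖ ≤ Ku * D := by
    have e : density f • (bulkVelocity f - bulkVelocity g)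
        = ((∫ v, f v • v) - ∫ v, g v • v) - (density f - density g) • bulkVelocity g := by
      rw [← density_smul_bulkVelocity hρf.ne', ← density_smul_bulkVelocity hρg.ne', smul_sub,
        sub_smul]
      abel
    have e2 : density f * ‖bulkVelocity f - bulkVelocity g‖ ≤ D + D * M.umax := by
      rw [← Real.norm_of_nonneg hρf.le, ← norm_smul, e]
      refine (norm_sub_le _ _).trans (add_le_add (norm_momentum_sub_le f g) ?_)
      rw [norm_smul, Real.norm_eq_abs]
      exact mul_le_mul d1 hg.u_le (norm_nonneg _) hD
    rw [hKu, div_mul_eq_mul_div, le_div_iff₀ hρm]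
    nlinarith [hf.le_ρ, norm_nonneg (bulkVelocity f - bulkVelocity g)]
  have d3 : |energy f / density f - energy g / density g| ≤ Ke * D := by
    have eg : energy g / density g = 3 * temperature g + ‖bulkVelocity g‖ ^ 2 := by
      rw [temperature_eq hρg.ne']; field_simp; ring
    have bg : |energy g / density g| ≤ 3 * M.Tmax + M.umax ^ 2 := by
      rw [eg, abs_of_nonneg (by have := hg.T_pos; positivity)]
      have := hg.u_le
      have := hg.T_le
      gcongr
    have e : density f * (energy f / density f - energy g / density g)
        = (energy f - energy g) - (density f - density g) * (energy g / density g) := by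
      field_simp
      ring
    have e2 : density f * |energy f / density f - energy g / density g|
        ≤ D + D * (3 * M.Tmax + M.umax ^ 2) := by
      rw [← abs_of_pos hρf, ← abs_mul, abs_of_pos hρf, e]
      refine (abs_sub _ _).trans (add_le_add (abs_energy_sub_le f g) ?_)
      rw [abs_mul]
      exact mul_le_mul d1 bg (abs_nonneg _) hD
    rw [hKe, div_mul_eq_mul_div, le_div_iff₀ hρm]
    nlinarith [hf.le_ρ, abs_nonneg (energy f / density f - energy g / density g)]
  have d4 : |‖bulkVelocity f‖ ^ 2 - ‖bulkVelocity g‖ ^ 2| ≤ 2 * M.umax * (Ku * D) := by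
    rw [sq_sub_sq, abs_mul, abs_of_nonneg (by positivity)]
    have := hf.u_le
    have := hg.u_le
    refine mul_le_mul (by linarith) ((abs_norm_sub_norm_le _ _).trans d2) (abs_nonneg _)
      (by positivity)
  have d5 : |temperature f - temperature g| ≤ Ke * D / 3 + 2 * M.umax * (Ku * D) / 3 := by
    have e : temperature f - temperature g = (energy f / density f - energy g / density g) / 3
        - (‖bulkVelocity f‖ ^ 2 - ‖bulkVelocity g‖ ^ 2) / 3 := by
      rw [temperature_eq hρf.ne', temperature_eq hρg.ne']; field_simp; ring
    rw [e]
    refine (abs_sub _ _).trans ?_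
    rw [abs_div, abs_div, abs_of_pos (by norm_num : (0 : ℝ) < 3)]
    gcongr
  calc _ ≤ D + Ku * D + (Ke * D / 3 + 2 * M.umax * (Ku * D) / 3) :=
      add_le_add (add_le_add d1 d2) d5
    _ = _ := by ring

theorem exists_isMaxwellianLipschitz (M : StructuralConstants) :
    ∃ c L : ℝ, 0 < c ∧ 0 < L ∧ IsMaxwellianLipschitz M c L := by
  obtain ⟨c, L, hc, hL, h⟩ := exists_abs_maxwellian_sub_le M
  obtain ⟨K, hK, hK'⟩ := exists_parameters_sub_le M
  refine ⟨c, L * K, hc, by positivity, fun τ _ f g hf hg p hp v => ?_⟩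
  refine (h _ _ _ _ _ _ (hf.admissible hp) (hg.admissible hp) v).trans ?_
  calc _ ≤ L * Real.exp (-c * ‖v‖ ^ 2) * (K * weightedDist (f p) (g p)) := by
        gcongr
        exact hK' _ _ (hf.admissible hp) (hg.admissible hp)
    _ = _ := by rw [weightedDist]; ring

/-! ### Calculus on the space-time cylinder -/

lemma isCompact_cylinder (τ : ℝ) : IsCompact (cylinder τ) := isCompact_Icc.prod isCompact_Icc

lemma isCompact_cube : IsCompact (Icc (0 : Pos) 1) := isCompact_Icc

lemma uniqueDiffOn_cylinder {τ : ℝ} (hτ : 0 < τ) : UniqueDiffOn ℝ (cylinder τ) := by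
  refine (uniqueDiffOn_Icc hτ).prod ?_
  rw [← pi_univ_Icc]
  exact UniqueDiffOn.univ_pi fun _ => uniqueDiffOn_Icc one_pos

lemma prod_restrict_cylinder (t : ℝ) :
    ((volume : Measure ℝ).restrict (Icc 0 t)).prod ((volume : Measure Pos).restrict (Icc 0 1))
      = (volume : Measure (ℝ × Pos)).restrict (cylinder t) := by
  rw [Measure.prod_restrict]; rfl

lemma insertNth_mem_cube {i : Fin 3} {c : ℝ} (hc : c ∈ Icc (0 : ℝ) 1) {y : Fin 2 → ℝ}
    (hy : y ∈ Icc (0 : Fin 2 → ℝ) 1) : (i.insertNth c y : Pos) ∈ Icc (0 : Pos) 1 := by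
  constructor
  · intro j
    refine i.succAboveCases (by simpa using hc.1) (fun k => ?_) j
    simpa using hy.1 k
  · intro j
    refine i.succAboveCases (by simpa using hc.2) (fun k => ?_) j
    simpa using hy.2 k

lemma continuous_insertNth (i : Fin 3) (c : ℝ) :
    Continuous fun y : Fin 2 → ℝ => (i.insertNth c y : Pos) := by
  refine continuous_pi fun j => ?_
  refine i.succAboveCases (by simpa using continuous_const) (fun k => ?_) j
  simpa using continuous_apply k

/-- A function on the cylinder, restricted to a face of the cube, is continuous in time and in the
coordinates on the face. -/
lemma continuousOn_face {E : Type*} [TopologicalSpace E] {τ : ℝ} {F : ℝ × Pos → E}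
    (hF : ContinuousOn F (cylinder τ)) (i : Fin 3) {c : ℝ} (hc : c ∈ Icc (0 : ℝ) 1) :
    ContinuousOn (fun q : ℝ × (Fin 2 → ℝ) => F (q.1, i.insertNth c q.2))
      (Icc 0 τ ×ˢ Icc (0 : Fin 2 → ℝ) 1) :=
  hF.comp (continuous_fst.prodMk ((continuous_insertNth i c).comp continuous_snd)).continuousOn
    fun _ hq => ⟨hq.1, insertNth_mem_cube hc hq.2⟩

lemma continuousOn_slice {E : Type*} [TopologicalSpace E] {τ : ℝ} {F : ℝ × Pos → E}
    (hF : ContinuousOn F (cylinder τ)) {t : ℝ} (ht : t ∈ Icc 0 τ) :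
    ContinuousOn (fun x => F (t, x)) (Icc (0 : Pos) 1) :=
  hF.comp (by fun_prop) fun _ hx => ⟨ht, hx⟩

/-- Integrals over a compact set depending continuously on a parameter. -/
lemma continuousOn_setIntegral {X : Type*} [TopologicalSpace X] [MeasurableSpace X]
    [OpensMeasurableSpace X] [SecondCountableTopology X] {μ : Measure X}
    [IsFiniteMeasureOnCompacts μ] {τ : ℝ} {S : Set X} (hS : IsCompact S) (hSm : MeasurableSet S)
    {F : ℝ × X → ℝ} (hF : ContinuousOn F (Icc 0 τ ×ˢ S)) :
    ContinuousOn (fun s => ∫ x in S, F (s, x) ∂μ) (Icc 0 τ) := by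
  obtain ⟨C, hC⟩ := (isCompact_Icc.prod hS).exists_bound_of_continuousOn hF
  have := hS.measure_lt_top (μ := μ)
  have : IsFiniteMeasure (μ.restrict S) := ⟨by simpa using this⟩
  refine continuousOn_of_dominated (bound := fun _ => C) ?_ ?_ (integrable_const _) ?_
  · intro s hs
    have : ContinuousOn (fun x => F (s, x)) S := hF.comp (by fun_prop) fun _ hx => ⟨hs, hx⟩
    exact this.aestronglyMeasurable hSm
  · intro s hs
    exact (ae_restrict_mem hSm).mono fun x hx => hC (s, x) ⟨hs, hx⟩
  · exact (ae_restrict_mem hSm).mono fun x hx =>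
      hF.comp (by fun_prop) fun _ hs => ⟨hs, hx⟩

/-- Fundamental theorem of calculus in time, integrated over the cube. -/
lemma setIntegral_sub_eq_integral_time {τ : ℝ} (hτ : 0 < τ) {Φ : ℝ × Pos → ℝ}
    (hΦ : ContDiffOn ℝ 1 Φ (cylinder τ)) {t : ℝ} (ht : t ∈ Icc 0 τ) :
    (∫ x in Icc (0 : Pos) 1, Φ (t, x)) - ∫ x in Icc (0 : Pos) 1, Φ (0, x)
      = ∫ s in Icc 0 t, ∫ x in Icc (0 : Pos) 1, fderivWithin ℝ Φ (cylinder τ) (s, x) (1, 0) := by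
  have hsub : cylinder t ⊆ cylinder τ := prod_mono_left (Icc_subset_Icc_right ht.2)
  have hc : ContinuousOn (fun p => fderivWithin ℝ Φ (cylinder τ) p (1, 0)) (cylinder τ) :=
    (hΦ.continuousOn_fderivWithin (uniqueDiffOn_cylinder hτ) le_rfl).clm_apply continuousOn_const
  have h0 : (0 : ℝ) ∈ Icc 0 τ := ⟨le_rfl, hτ.le⟩
  rw [integral_integral_swap, ← integral_sub]
  · refine setIntegral_congr_fun measurableSet_Icc fun x hx => ?_
    have hx' : ∀ s ∈ Icc 0 t, (s, x) ∈ cylinder τ := fun s hs => ⟨Icc_subset_Icc_right ht.2 hs, hx⟩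
    rw [integral_Icc_eq_integral_Ioc, ← intervalIntegral.integral_of_le ht.1,
      intervalIntegral.integral_eq_sub_of_hasDerivAt_of_le (f := fun s => Φ (s, x)) ht.1]
    · exact hΦ.continuousOn.comp (by fun_prop) hx'
    · intro s hs
      have hs' : (s, x) ∈ cylinder τ := hx' s (Ioo_subset_Icc_self hs)
      have h1 := (hΦ.differentiableOn one_ne_zero (s, x) hs').hasFDerivWithinAt
      have h2 : HasDerivWithinAt (fun r : ℝ => (r, x)) ((1 : ℝ), (0 : Pos)) (Icc 0 t) s :=
        ((hasDerivAt_id s).prodMk (hasDerivAt_const s x)).hasDerivWithinAt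
      exact (h1.comp_hasDerivWithinAt s h2 hx').hasDerivAt (Icc_mem_nhds hs.1 hs.2)
    · refine ContinuousOn.intervalIntegrable ?_
      rw [uIcc_of_le ht.1]
      exact hc.comp (by fun_prop) hx'
  · exact (continuousOn_slice hΦ.continuousOn ht).integrableOn_compact isCompact_cube
  · exact (continuousOn_slice hΦ.continuousOn h0).integrableOn_compact isCompact_cube
  · rw [prod_restrict_cylinder]
    exact (hc.mono hsub).integrableOn_compact (isCompact_cylinder t)

/-- The flux of `Ψ` through the pair of faces `xᵢ = 0`, `xᵢ = 1`. -/
noncomputable def faceFlux (Ψ : ℝ × Pos → ℝ) (i : Fin 3) (s : ℝ) : ℝ :=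
  ∫ y in Icc (0 : Fin 2 → ℝ) 1, (Ψ (s, i.insertNth 1 y) - Ψ (s, i.insertNth 0 y))

lemma continuousOn_faceFlux {τ : ℝ} {Ψ : ℝ × Pos → ℝ} (hΨ : ContinuousOn Ψ (cylinder τ))
    (i : Fin 3) : ContinuousOn (faceFlux Ψ i) (Icc 0 τ) :=
  continuousOn_setIntegral isCompact_Icc measurableSet_Icc
    (F := fun q : ℝ × (Fin 2 → ℝ) => Ψ (q.1, i.insertNth 1 q.2) - Ψ (q.1, i.insertNth 0 q.2))
    ((continuousOn_face hΨ i (right_mem_Icc.2 zero_le_one)).sub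
      (continuousOn_face hΨ i (left_mem_Icc.2 zero_le_one)))

/-- Divergence theorem on the cube, at a fixed time. -/
lemma setIntegral_divergence_eq_sum_faceFlux {τ : ℝ} (hτ : 0 < τ) {Ψ : Fin 3 → ℝ × Pos → ℝ}
    (hΨ : ∀ i, ContDiffOn ℝ 1 (Ψ i) (cylinder τ)) {s : ℝ} (hs : s ∈ Icc 0 τ) :
    ∫ x in Icc (0 : Pos) 1, ∑ i, fderivWithin ℝ (Ψ i) (cylinder τ) (s, x) (0, Pi.single i 1)
      = ∑ i, faceFlux (Ψ i) i s := by
  have hc : ∀ i, ContinuousOn (fun p => fderivWithin ℝ (Ψ i) (cylinder τ) p) (cylinder τ) :=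
    fun i => (hΨ i).continuousOn_fderivWithin (uniqueDiffOn_cylinder hτ) le_rfl
  have hm : ∀ x ∈ Icc (0 : Pos) 1, (s, x) ∈ cylinder τ := fun x hx => ⟨hs, hx⟩
  have key := integral_divergence_of_hasFDerivAt_off_countable' (n := 2) (0 : Pos) 1 zero_le_one
    (fun i x => Ψ i (s, x))
    (fun i x => (fderivWithin ℝ (Ψ i) (cylinder τ) (s, x)).comp
      (ContinuousLinearMap.inr ℝ ℝ Pos)) ∅ countable_empty
    (fun i => continuousOn_slice (hΨ i).continuousOn hs) ?_ ?_
  · simp only [ContinuousLinearMap.comp_apply, ContinuousLinearMap.inr_apply] at key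
    rw [key]
    refine Finset.sum_congr rfl fun i _ => ?_
    have hi : ∀ c ∈ Icc (0 : ℝ) 1, IntegrableOn (fun y : Fin 2 → ℝ => Ψ i (s, i.insertNth c y))
        (Icc 0 1) := fun c hc' =>
      ((continuousOn_face (hΨ i).continuousOn i hc').comp (f := fun y : Fin 2 → ℝ => (s, y))
        (by fun_prop) fun y hy => ⟨hs, hy⟩).integrableOn_compact isCompact_Icc
    rw [faceFlux, integral_sub (hi 1 (right_mem_Icc.2 zero_le_one))
      (hi 0 (left_mem_Icc.2 zero_le_one))]
    rfl
  · intro x hx i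
    have hx' : Icc (0 : Pos) 1 ∈ nhds x := by
      rw [← pi_univ_Icc]
      exact set_pi_mem_nhds finite_univ fun j _ =>
        Icc_mem_nhds (hx.1 j trivial).1 (hx.1 j trivial).2
    have h1 := ((hΨ i).differentiableOn one_ne_zero (s, x)
      (hm x (mem_of_mem_nhds hx'))).hasFDerivWithinAt
    have h2 : HasFDerivWithinAt (fun y : Pos => (s, y)) (ContinuousLinearMap.inr ℝ ℝ Pos)
        (Icc 0 1) x := (hasFDerivAt_prodMk_right s x).hasFDerivWithinAt
    exact (h1.comp x h2 hm).hasFDerivAt hx'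
  · refine ContinuousOn.integrableOn_compact isCompact_cube ?_
    refine continuousOn_finsetSum _ fun i _ => ContinuousOn.clm_apply ?_ continuousOn_const
    exact ContinuousOn.clm_comp ((hc i).comp (by fun_prop) hm) continuousOn_const

/-- No integrability is needed: the Bochner integral of a non-integrable function is `0`. -/
lemma ofReal_integral_le_lintegral {α : Type*} [MeasurableSpace α] {μ : Measure α} (f : α → ℝ) :
    ENNReal.ofReal (∫ a, f a ∂μ) ≤ ∫⁻ a, ENNReal.ofReal (f a) ∂μ := by
  by_cases hf : Integrable f μ
  · calc ENNReal.ofReal (∫ a, f a ∂μ) ≤ ENNReal.ofReal (∫ a, max (f a) 0 ∂μ) :=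
          ENNReal.ofReal_le_ofReal
            (integral_mono hf hf.pos_part fun a => le_max_left _ _)
      _ = ∫⁻ a, ENNReal.ofReal (max (f a) 0) ∂μ :=
          ofReal_integral_eq_lintegral_ofReal hf.pos_part (.of_forall fun a => le_max_right _ _)
      _ = _ := by simp
  · simp [integral_undef hf]

/-- Integrated form of the balance law `∂ₜΦ + ∑ᵢ ∂ᵢΨᵢ = D` on the cylinder, as an inequality. -/
lemma ofReal_setIntegral_le_of_balance {τ : ℝ} (hτ : 0 < τ) {Φ D : ℝ × Pos → ℝ}
    {Ψ : Fin 3 → ℝ × Pos → ℝ} (hΦ : ContDiffOn ℝ 1 Φ (cylinder τ))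
    (hΨ : ∀ i, ContDiffOn ℝ 1 (Ψ i) (cylinder τ))
    (hD : ∀ p ∈ cylinder τ, D p = fderivWithin ℝ Φ (cylinder τ) p (1, 0)
      + ∑ i, fderivWithin ℝ (Ψ i) (cylinder τ) p (0, Pi.single i 1)) {t : ℝ} (ht : t ∈ Icc 0 τ) :
    ENNReal.ofReal (∫ x in Icc (0 : Pos) 1, Φ (t, x))
      ≤ ENNReal.ofReal (∫ x in Icc (0 : Pos) 1, Φ (0, x))
        + (∫⁻ s in Icc 0 t, ∫⁻ x in Icc (0 : Pos) 1, ENNReal.ofReal (D (s, x)))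
        + ∑ i, ∫⁻ s in Icc 0 t, ENNReal.ofReal |faceFlux (Ψ i) i s| := by
  have hU := uniqueDiffOn_cylinder hτ
  have hcΨ : ContinuousOn (fun p => ∑ i, fderivWithin ℝ (Ψ i) (cylinder τ) p (0, Pi.single i 1))
      (cylinder τ) := continuousOn_finsetSum _ fun i _ =>
    ((hΨ i).continuousOn_fderivWithin hU le_rfl).clm_apply continuousOn_const
  have hcΦ : ContinuousOn (fun p => fderivWithin ℝ Φ (cylinder τ) p (1, 0)) (cylinder τ) :=
    (hΦ.continuousOn_fderivWithin hU le_rfl).clm_apply continuousOn_const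
  have hcD : ContinuousOn D (cylinder τ) := (hcΦ.add hcΨ).congr hD
  have hsub : Icc 0 t ⊆ Icc 0 τ := Icc_subset_Icc_right ht.2
  have hm : ∀ i, AEMeasurable (fun s => ENNReal.ofReal |faceFlux (Ψ i) i s|)
      (volume.restrict (Icc 0 t)) := fun i =>
    (((continuousOn_faceFlux (hΨ i).continuousOn i).mono hsub).abs.aestronglyMeasurable
      measurableSet_Icc).aemeasurable.ennreal_ofReal
  have hpt : ∀ s ∈ Icc 0 t,
      ENNReal.ofReal (∫ x in Icc (0 : Pos) 1, fderivWithin ℝ Φ (cylinder τ) (s, x) (1, 0))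
        ≤ (∫⁻ x in Icc (0 : Pos) 1, ENNReal.ofReal (D (s, x)))
          + ∑ i, ENNReal.ofReal |faceFlux (Ψ i) i s| := by
    intro s hs
    have e : ∫ x in Icc (0 : Pos) 1, fderivWithin ℝ Φ (cylinder τ) (s, x) (1, 0)
        = (∫ x in Icc (0 : Pos) 1, D (s, x)) - ∑ i, faceFlux (Ψ i) i s := by
      rw [← setIntegral_divergence_eq_sum_faceFlux hτ hΨ (hsub hs), ← integral_sub]
      · refine setIntegral_congr_fun measurableSet_Icc fun x hx => ?_
        rw [hD (s, x) ⟨hsub hs, hx⟩, add_sub_cancel_right]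
      · exact (continuousOn_slice hcD (hsub hs)).integrableOn_compact isCompact_cube
      · exact (continuousOn_slice hcΨ (hsub hs)).integrableOn_compact isCompact_cube
    calc _ ≤ ENNReal.ofReal ((∫ x in Icc (0 : Pos) 1, D (s, x))
            + ∑ i, |faceFlux (Ψ i) i s|) := by
          refine ENNReal.ofReal_le_ofReal ?_
          rw [e]
          linarith [neg_abs_le (∑ i, faceFlux (Ψ i) i s),
            Finset.abs_sum_le_sum_abs (fun i => faceFlux (Ψ i) i s) Finset.univ]
      _ ≤ ENNReal.ofReal (∫ x in Icc (0 : Pos) 1, D (s, x))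
            + ENNReal.ofReal (∑ i, |faceFlux (Ψ i) i s|) := ENNReal.ofReal_add_le
      _ ≤ _ := by
          rw [ENNReal.ofReal_sum_of_nonneg fun i _ => abs_nonneg _]
          gcongr
          exact ofReal_integral_le_lintegral _
  have h := setIntegral_sub_eq_integral_time hτ hΦ ht
  rw [sub_eq_iff_eq_add'] at h
  rw [h, add_assoc]
  refine ENNReal.ofReal_add_le.trans (add_le_add le_rfl ?_)
  refine (ofReal_integral_le_lintegral _).trans ?_
  refine (setLIntegral_mono_ae' measurableSet_Icc (.of_forall hpt)).trans ?_
  rw [lintegral_add_right' _ (Finset.aemeasurable_fun_sum _ fun i _ => hm i),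
    lintegral_finsetSum' _ fun i _ => hm i]

/-! ### Weighted quadratic forms in the velocity -/

/-- The component in `L²`. -/
noncomputable def toL2 : VSpace →L[ℝ] Lp ℝ 2 (volume : Measure Vel) :=
  (ContinuousLinearMap.snd ℝ _ _).comp VSpace.subtypeL

/-- The component in `L¹₂`. -/
noncomputable def toL1 : VSpace →L[ℝ] Lp ℝ 1 weightedVolume :=
  (ContinuousLinearMap.fst ℝ _ _).comp VSpace.subtypeL

/-- The bilinear form `(a, b) ↦ ∫ θ a b dv`, for a bounded weight `θ`. -/
noncomputable def velForm {θ : Vel → ℝ} (hθ : MemLp θ ∞ volume) : VSpace →L[ℝ] VSpace →L[ℝ] ℝ :=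
  ((ContinuousLinearMap.mul ℝ ℝ).lpPairing (volume : Measure Vel) 2 2).bilinearComp
    (((ContinuousLinearMap.mul ℝ ℝ).holderL volume ∞ 2 2 hθ.toLp).comp toL2) toL2

lemma velForm_apply {θ : Vel → ℝ} (hθ : MemLp θ ∞ volume) (a b : VSpace) :
    velForm hθ a b = ∫ v, θ v * (a v * b v) := by
  simp only [velForm, ContinuousLinearMap.bilinearComp_apply, ContinuousLinearMap.comp_apply,
    ContinuousLinearMap.lpPairing_eq_integral]
  refine integral_congr_ae ?_
  filter_upwards [(ContinuousLinearMap.mul ℝ ℝ).coeFn_holder (r := 2) hθ.toLp (toL2 a),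
    hθ.coeFn_toLp] with v h1 h2
  simp only [ContinuousLinearMap.holderL_apply_apply, ContinuousLinearMap.mul_apply'] at h1 ⊢
  rw [h1, h2, mul_assoc]
  rfl

lemma integrable_mul_mul {θ : Vel → ℝ} (hθ : MemLp θ ∞ volume) (a b : VSpace) :
    Integrable fun v => θ v * (a v * b v) := by
  have h : Integrable fun v => a v * b v := (Lp.memLp a.1.2).integrable_mul (Lp.memLp b.1.2)
  exact MemLp.integrable_mul hθ (memLp_one_iff_integrable.2 h)

lemma velForm_comm {θ : Vel → ℝ} (hθ : MemLp θ ∞ volume) (a b : VSpace) :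
    velForm hθ a b = velForm hθ b a := by
  simp only [velForm_apply, mul_comm (a _)]

lemma contDiffOn_quadratic {V : Type*} [NormedAddCommGroup V] [NormedSpace ℝ V]
    (B : V →L[ℝ] V →L[ℝ] ℝ) {τ : ℝ} {h : ℝ × Pos → V} (hh : ContDiffOn ℝ 1 h (cylinder τ)) :
    ContDiffOn ℝ 1 (fun p => B (h p) (h p)) (cylinder τ) :=
  (B.contDiff.comp_contDiffOn hh).clm_apply hh

lemma fderivWithin_quadratic {V : Type*} [NormedAddCommGroup V] [NormedSpace ℝ V]
    (B : V →L[ℝ] V →L[ℝ] ℝ) (hB : ∀ a b, B a b = B b a) {τ : ℝ} (hτ : 0 < τ) {h : ℝ × Pos → V}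
    (hh : ContDiffOn ℝ 1 h (cylinder τ)) {p : ℝ × Pos} (hp : p ∈ cylinder τ) (e : ℝ × Pos) :
    fderivWithin ℝ (fun p => B (h p) (h p)) (cylinder τ) p e
      = 2 * B (h p) (fderivWithin ℝ h (cylinder τ) p e) := by
  have hd := hh.differentiableOn one_ne_zero p hp
  rw [B.fderivWithin_of_bilinear hd hd (uniqueDiffOn_cylinder hτ p hp), two_mul]
  change B (h p) _ + B _ (h p) = _
  rw [hB _ (h p)]
  rfl

/-- The quadratic form `e ↦ ∫ θ e² dv`. -/
noncomputable def velQuad (θ : Vel → ℝ) (e : VSpace) : ℝ := ∫ v, θ v * (e v * e v)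

lemma velForm_self {θ : Vel → ℝ} (hθ : MemLp θ ∞ volume) (e : VSpace) :
    velForm hθ e e = velQuad θ e := velForm_apply hθ e e

lemma contDiffOn_velQuad {τ : ℝ} {h : ℝ × Pos → VSpace} (hh : ContDiffOn ℝ 1 h (cylinder τ))
    {θ : Vel → ℝ} (hθ : MemLp θ ∞ volume) :
    ContDiffOn ℝ 1 (fun p => velQuad θ (h p)) (cylinder τ) := by
  simp only [← velForm_self hθ]
  exact contDiffOn_quadratic (velForm hθ) hh

lemma continuous_velQuad {θ : Vel → ℝ} (hθ : MemLp θ ∞ volume) : Continuous (velQuad θ) := by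
  have h : velQuad θ = fun e => velForm hθ e e := funext fun e => (velForm_self hθ e).symm
  rw [h]
  exact (velForm hθ).continuous.clm_apply continuous_id

lemma fderivWithin_velQuad {τ : ℝ} (hτ : 0 < τ) {h : ℝ × Pos → VSpace}
    (hh : ContDiffOn ℝ 1 h (cylinder τ)) {θ : Vel → ℝ} (hθ : MemLp θ ∞ volume) {p : ℝ × Pos}
    (hp : p ∈ cylinder τ) (e : ℝ × Pos) :
    fderivWithin ℝ (fun p => velQuad θ (h p)) (cylinder τ) p e
      = 2 * ∫ v, θ v * (h p v * fderivWithin ℝ h (cylinder τ) p e v) := by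
  simp only [← velForm_self hθ]
  rw [fderivWithin_quadratic (velForm hθ) (velForm_comm hθ) hτ hh hp, velForm_apply]

lemma velQuad_sub_velQuad {θ : Vel → ℝ} (hθ : MemLp θ ∞ volume) (a b : VSpace) :
    velQuad θ a - velQuad θ b = ∫ v, θ v * ((a - b) v * (a + b) v) := by
  rw [velQuad, velQuad, ← integral_sub (integrable_mul_mul hθ a a) (integrable_mul_mul hθ b b)]
  have hadd : (a + b : VSpace) =ᵐ[volume] fun v => a v + b v := Lp.coeFn_add a.1.2 b.1.2
  refine integral_congr_ae ?_
  filter_upwards [coeFn_sub a b, hadd] with v h1 h2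
  rw [h1, h2]
  ring

/-! ### Cauchy–Schwarz inequalities -/

lemma sq_lintegral_mul_le {α : Type*} [MeasurableSpace α] {μ : Measure α} {φ ψ : α → ℝ≥0∞}
    (hφ : AEMeasurable φ μ) (hψ : AEMeasurable ψ μ) :
    (∫⁻ a, φ a * ψ a ∂μ) ^ 2 ≤ (∫⁻ a, φ a ^ 2 ∂μ) * ∫⁻ a, ψ a ^ 2 ∂μ := by
  have h := ENNReal.lintegral_mul_le_Lp_mul_Lq μ Real.HolderConjugate.two_two hφ hψ
  simp only [Pi.mul_apply, ENNReal.rpow_two] at h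
  refine (pow_le_pow_left' h 2).trans_eq ?_
  rw [mul_pow]
  simp only [← ENNReal.rpow_natCast, ← ENNReal.rpow_mul]
  norm_num

lemma sq_lintegral_le {α : Type*} [MeasurableSpace α] {μ : Measure α} {φ : α → ℝ≥0∞}
    (hφ : AEMeasurable φ μ) : (∫⁻ a, φ a ∂μ) ^ 2 ≤ μ univ * ∫⁻ a, φ a ^ 2 ∂μ := by
  simpa [mul_comm] using sq_lintegral_mul_le hφ (aemeasurable_const (b := 1))

/-- The squared `L²` norm as a lower Lebesgue integral. -/
lemma lintegral_ofReal_sq_eq (e : VSpace) :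
    ∫⁻ v, ENNReal.ofReal (e v ^ 2) = ENNReal.ofReal (l2norm e ^ 2) := by
  have h1 : l2norm e ^ 2 = ∫ v, e v ^ 2 := by
    rw [l2norm, ← real_inner_self_eq_norm_sq, L2.inner_def]
    exact integral_congr_ae (.of_forall fun v => by simp [sq])
  rw [h1, ofReal_integral_eq_lintegral_ofReal (Lp.memLp e.1.2).integrable_sq
    (.of_forall fun v => sq_nonneg _)]

lemma ofReal_abs_integral_mul_mul_sq_le {θ : Vel → ℝ} (hθ : MemLp θ ∞ volume) (k e : VSpace) :
    ENNReal.ofReal |∫ v, θ v * (k v * e v)| ^ 2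
      ≤ (∫⁻ v, ENNReal.ofReal ((θ v * k v) ^ 2)) * ENNReal.ofReal (l2norm e ^ 2) := by
  have hk := aestronglyMeasurable_coeFn k
  have he := aestronglyMeasurable_coeFn e
  have e1 : ∀ x : ℝ, ENNReal.ofReal |x| ^ 2 = ENNReal.ofReal (x ^ 2) := fun x => by
    rw [← ENNReal.ofReal_pow (abs_nonneg x), sq_abs]
  have h1 : ENNReal.ofReal |∫ v, θ v * (k v * e v)|
      ≤ ∫⁻ v, ENNReal.ofReal |θ v * k v| * ENNReal.ofReal |e v| := by
    refine (ENNReal.ofReal_le_ofReal (abs_integral_le_integral_abs)).trans ?_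
    refine (ofReal_integral_le_lintegral _).trans_eq (lintegral_congr fun v => ?_)
    rw [← ENNReal.ofReal_mul (abs_nonneg _), ← abs_mul, mul_assoc]
  refine (pow_le_pow_left' h1 2).trans ((sq_lintegral_mul_le
    (hθ.1.mul hk).aemeasurable.abs.ennreal_ofReal
    he.aemeasurable.abs.ennreal_ofReal).trans_eq ?_)
  simp only [e1]
  rw [lintegral_ofReal_sq_eq e]
  rfl

/-! ### Truncation of the weight -/

/-- The squared weight `w²`, truncated to a bounded function vanishing for `|v| > n`. -/
noncomputable def truncSq (w : Vel → ℝ) (n : ℕ) (v : Vel) : ℝ :=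
  if ‖v‖ ≤ n then min (w v) n ^ 2 else 0

section truncSq

variable {w : Vel → ℝ}

lemma truncSq_nonneg (w : Vel → ℝ) (n : ℕ) (v : Vel) : 0 ≤ truncSq w n v := by
  unfold truncSq; split_ifs <;> positivity

lemma truncSq_le_sq (hw1 : ∀ v, 1 ≤ w v) (n : ℕ) (v : Vel) : truncSq w n v ≤ w v ^ 2 := by
  have h0 : 0 ≤ w v := zero_le_one.trans (hw1 v)
  unfold truncSq
  split_ifs
  · exact pow_le_pow_left₀ (le_min h0 n.cast_nonneg) (min_le_left _ _) 2
  · positivity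

lemma truncSq_mono (hw1 : ∀ v, 1 ≤ w v) (v : Vel) : Monotone fun n => truncSq w n v := by
  intro n m hnm
  have h0 : 0 ≤ w v := zero_le_one.trans (hw1 v)
  have hnm' : (n : ℝ) ≤ m := Nat.cast_le.2 hnm
  simp only
  by_cases h : ‖v‖ ≤ n
  · rw [truncSq, truncSq, if_pos h, if_pos (h.trans hnm')]
    exact pow_le_pow_left₀ (le_min h0 n.cast_nonneg) (min_le_min_left _ hnm') 2
  · rw [truncSq, if_neg h]
    exact truncSq_nonneg _ _ _

lemma exists_truncSq_eq (w : Vel → ℝ) (v : Vel) : ∃ n, truncSq w n v = w v ^ 2 := by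
  obtain ⟨n, hn⟩ := exists_nat_ge (max ‖v‖ (w v))
  refine ⟨n, ?_⟩
  rw [truncSq, if_pos ((le_max_left _ _).trans hn), min_eq_left ((le_max_right _ _).trans hn)]

lemma aestronglyMeasurable_truncSq (hw : AEMeasurable w) (n : ℕ) :
    AEStronglyMeasurable (truncSq w n) volume := by
  have h : truncSq w n = {v : Vel | ‖v‖ ≤ n}.indicator fun v => min (w v) n ^ 2 := by
    ext v; simp [truncSq, indicator_apply]
  rw [h]
  exact (((hw.min aemeasurable_const).pow_const 2).indicator
    (measurableSet_le measurable_norm measurable_const)).aestronglyMeasurable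

lemma abs_truncSq_le (hw1 : ∀ v, 1 ≤ w v) (n : ℕ) (v : Vel) : |truncSq w n v| ≤ (n : ℝ) ^ 2 := by
  rw [abs_of_nonneg (truncSq_nonneg _ _ _)]
  unfold truncSq
  split_ifs
  · exact pow_le_pow_left₀ (le_min (zero_le_one.trans (hw1 v)) n.cast_nonneg) (min_le_right _ _) 2
  · positivity

lemma memLp_truncSq (hw : AEMeasurable w) (hw1 : ∀ v, 1 ≤ w v) (n : ℕ) :
    MemLp (truncSq w n) ∞ volume :=
  memLp_top_of_bound (aestronglyMeasurable_truncSq hw n) ((n : ℝ) ^ 2)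
    (.of_forall fun v => abs_truncSq_le hw1 n v)

lemma memLp_coord_mul_truncSq (hw : AEMeasurable w) (hw1 : ∀ v, 1 ≤ w v) (n : ℕ) (i : Fin 3) :
    MemLp (fun v : Vel => v i * truncSq w n v) ∞ volume := by
  have hc : Continuous fun v : Vel => v i := by fun_prop
  refine memLp_top_of_bound (hc.aestronglyMeasurable.mul (aestronglyMeasurable_truncSq hw n))
    ((n : ℝ) * (n : ℝ) ^ 2) (.of_forall fun v => ?_)
  rw [norm_mul]
  by_cases h : ‖v‖ ≤ n
  · exact mul_le_mul ((PiLp.norm_apply_le v i).trans h) (abs_truncSq_le hw1 n v) (norm_nonneg _)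
      n.cast_nonneg
  · rw [truncSq, if_neg h, norm_zero, mul_zero]
    positivity

lemma ofReal_velQuad_truncSq (hw : AEMeasurable w) (hw1 : ∀ v, 1 ≤ w v) (n : ℕ) (e : VSpace) :
    ENNReal.ofReal (velQuad (truncSq w n) e)
      = ∫⁻ v, ENNReal.ofReal (truncSq w n v * e v ^ 2) := by
  rw [velQuad, ofReal_integral_eq_lintegral_ofReal 
    (integrable_mul_mul (memLp_truncSq hw hw1 n) e e)
    (.of_forall fun v => mul_nonneg (truncSq_nonneg _ _ _) (mul_self_nonneg _))]
  simp only [sq]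

lemma ofReal_velQuad_truncSq_le (hw : AEMeasurable w) (hw1 : ∀ v, 1 ≤ w v) (n : ℕ) (e : VSpace) :
    ENNReal.ofReal (velQuad (truncSq w n) e)
      ≤ ∫⁻ v, ENNReal.ofReal ((w v * e v) ^ 2) := by
  rw [ofReal_velQuad_truncSq hw hw1]
  refine lintegral_mono fun v => ENNReal.ofReal_le_ofReal ?_
  rw [mul_pow]
  exact mul_le_mul_of_nonneg_right (truncSq_le_sq hw1 n v) (sq_nonneg _)

lemma iSup_ofReal_velQuad_truncSq (hw : AEMeasurable w) (hw1 : ∀ v, 1 ≤ w v) (e : VSpace) :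
    ⨆ n, ENNReal.ofReal (velQuad (truncSq w n) e)
      = ∫⁻ v, ENNReal.ofReal ((w v * e v) ^ 2) := by
  refine le_antisymm (iSup_le fun n => ofReal_velQuad_truncSq_le hw hw1 n e) ?_
  simp only [ofReal_velQuad_truncSq hw hw1]
  rw [← lintegral_iSup']
  · refine lintegral_mono fun v => ?_
    obtain ⟨n, hn⟩ := exists_truncSq_eq w v
    refine le_iSup_of_le n ?_
    rw [hn, mul_pow]
  · intro n
    exact ((aestronglyMeasurable_truncSq hw n).aemeasurable.mul
      ((aestronglyMeasurable_coeFn e).aemeasurable.pow_const 2)).ennreal_ofReal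
  · exact .of_forall fun v n m hnm => ENNReal.ofReal_le_ofReal
      (mul_le_mul_of_nonneg_right (truncSq_mono hw1 v hnm) (sq_nonneg _))

lemma monotone_ofReal_velQuad_truncSq (hw : AEMeasurable w) (hw1 : ∀ v, 1 ≤ w v) (e : VSpace) :
    Monotone fun n => ENNReal.ofReal (velQuad (truncSq w n) e) := by
  intro n m hnm
  simp only [ofReal_velQuad_truncSq hw hw1]
  exact lintegral_mono fun v => ENNReal.ofReal_le_ofReal
    (mul_le_mul_of_nonneg_right (truncSq_mono hw1 v hnm) (sq_nonneg _))

/-- The weighted norm is the supremum of its truncations. -/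
lemma normSq_le_of_forall_truncSq (hw : AEMeasurable w) (hw1 : ∀ v, 1 ≤ w v) {h : Pos → VSpace}
    (hh : ContinuousOn h (Icc 0 1)) {E : ℝ≥0∞}
    (hE : ∀ n, ENNReal.ofReal (∫ x in Icc (0 : Pos) 1, velQuad (truncSq w n) (h x))
      ≤ E) :
    normSq (fun x v => w v * h x v) ≤ E := by
  have hc : ∀ n, ContinuousOn (fun x => velQuad (truncSq w n) (h x)) (Icc 0 1) :=
    fun n => (continuous_velQuad (memLp_truncSq hw hw1 n)).comp_continuousOn hh
  simp only [normSq, ← iSup_ofReal_velQuad_truncSq hw hw1]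
  rw [lintegral_iSup']
  · refine iSup_le fun n => (hE n).trans' ?_
    rw [ofReal_integral_eq_lintegral_ofReal ((hc n).integrableOn_compact isCompact_cube)]
    refine .of_forall fun x => ?_
    exact integral_nonneg fun v => mul_nonneg (truncSq_nonneg _ _ _) (mul_self_nonneg _)
  · exact fun n => ((hc n).aestronglyMeasurable measurableSet_Icc).aemeasurable.ennreal_ofReal
  · exact .of_forall fun x => monotone_ofReal_velQuad_truncSq hw hw1 (h x)

end truncSq

lemma aemeasurable_of_integrable_sq_mul_exp {w : Vel → ℝ} {c : ℝ} (hw1 : ∀ v, 1 ≤ w v)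
    (h : Integrable (fun v : Vel => w v ^ 2 * Real.exp (-2 * c * ‖v‖ ^ 2)) volume) :
    AEMeasurable w := by
  -- As `w ≥ 0`, it is the square root of `w²`.
  have h1 : AEMeasurable (fun v : Vel => Real.sqrt (w v ^ 2 * Real.exp (-2 * c * ‖v‖ ^ 2)
      * Real.exp (2 * c * ‖v‖ ^ 2))) :=
    (h.aestronglyMeasurable.aemeasurable.mul
      (by fun_prop : Continuous fun v : Vel => Real.exp (2 * c * ‖v‖ ^ 2)).aemeasurable).sqrt
  refine h1.congr (.of_forall fun v => ?_)
  simp only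
  rw [mul_assoc, ← Real.exp_add]
  simp [Real.sqrt_sq (zero_le_one.trans (hw1 v))]

/-- The weighted `L²` norm controls the `L¹₂` norm. -/
lemma ofReal_weightedDist_sq_le {w : Vel → ℝ} (hw : AEMeasurable w) (hw1 : ∀ v, 1 ≤ w v)
    (hint : Integrable (fun v : Vel => (1 + ‖v‖ ^ 2) ^ 2 / w v ^ 2) volume) (f g : VSpace) :
    ENNReal.ofReal (weightedDist f g ^ 2)
      ≤ ENNReal.ofReal (∫ v : Vel, (1 + ‖v‖ ^ 2) ^ 2 / w v ^ 2)
        * ∫⁻ v, ENNReal.ofReal ((w v * (f v - g v)) ^ 2) := by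
  have hf := (aestronglyMeasurable_coeFn f).aemeasurable
  have hg := (aestronglyMeasurable_coeFn g).aemeasurable
  have hw0 : ∀ v, 0 < w v := fun v => one_pos.trans_le (hw1 v)
  rw [ENNReal.ofReal_pow (weightedDist_nonneg f g),
    ofReal_integral_eq_lintegral_ofReal hint (.of_forall fun v => by positivity)]
  have h1 : ENNReal.ofReal (weightedDist f g)
      ≤ ∫⁻ v : Vel, ENNReal.ofReal ((1 + ‖v‖ ^ 2) / w v)
          * ENNReal.ofReal (w v * |f v - g v|) := by
    refine (ofReal_integral_le_lintegral _).trans_eq (lintegral_congr fun v => ?_)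
    have := hw0 v
    rw [← ENNReal.ofReal_mul (by positivity)]
    congr 1
    field_simp
  have hm : AEMeasurable fun v : Vel => 1 + ‖v‖ ^ 2 := by fun_prop
  refine (pow_le_pow_left' h1 2).trans ((sq_lintegral_mul_le (hm.div hw).ennreal_ofReal
    (hw.mul (hf.sub hg).abs).ennreal_ofReal).trans_eq ?_)
  congr 1
  · refine lintegral_congr fun v => ?_
    have := hw0 v
    change ENNReal.ofReal ((1 + ‖v‖ ^ 2) / w v) ^ 2 = _
    rw [← ENNReal.ofReal_pow (by positivity), div_pow]
  · refine lintegral_congr fun v => ?_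
    have := hw0 v
    change ENNReal.ofReal (w v * |f v - g v|) ^ 2 = _
    rw [← ENNReal.ofReal_pow (by positivity), mul_pow, sq_abs, ← mul_pow]

/-! ### Production term -/

lemma transport_sub_ae {τ : ℝ} (hτ : 0 < τ) {f g : ℝ × Pos → VSpace}
    (hf : ContDiffOn ℝ 1 f (cylinder τ)) (hg : ContDiffOn ℝ 1 g (cylinder τ)) {p : ℝ × Pos}
    (hp : p ∈ cylinder τ) :
    ∀ᵐ v, transport τ (fun p => f p - g p) p v = transport τ f p v - transport τ g p v := by
  have e : fderivWithin ℝ (fun p => f p - g p) (cylinder τ) p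
      = fderivWithin ℝ f (cylinder τ) p - fderivWithin ℝ g (cylinder τ) p :=
    fderivWithin_fun_sub (uniqueDiffOn_cylinder hτ p hp) (hf.differentiableOn one_ne_zero p hp)
      (hg.differentiableOn one_ne_zero p hp)
  have e' : ∀ d, fderivWithin ℝ (fun p => f p - g p) (cylinder τ) p d
      = fderivWithin ℝ f (cylinder τ) p d - fderivWithin ℝ g (cylinder τ) p d := fun d => by
    rw [e]; rfl
  have h2 : ∀ᵐ v : Vel, ∀ i : Fin 3,
      fderivWithin ℝ (fun p => f p - g p) (cylinder τ) p (0, Pi.single i 1) v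
        = fderivWithin ℝ f (cylinder τ) p (0, Pi.single i 1) v
          - fderivWithin ℝ g (cylinder τ) p (0, Pi.single i 1) v := by
    refine ae_all_iff.2 fun i => ?_
    rw [e']
    exact coeFn_sub _ _
  have h1 : ∀ᵐ v : Vel, fderivWithin ℝ (fun p => f p - g p) (cylinder τ) p (1, 0) v
        = fderivWithin ℝ f (cylinder τ) p (1, 0) v
          - fderivWithin ℝ g (cylinder τ) p (1, 0) v := by
    rw [e']
    exact coeFn_sub _ _
  filter_upwards [h1, h2] with v e1 e2
  simp only [transport, e1, e2, mul_sub, Finset.sum_sub_distrib]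
  ring

/-- The quadratic forms with weights `θ` and `vᵢ θ` obey a balance law whose production is
`2 ∫ θ h (∂ₜh + v · ∇ₓh) dv`. -/
lemma fderivWithin_velQuad_add_sum {τ : ℝ} (hτ : 0 < τ) {h : ℝ × Pos → VSpace}
    (hh : ContDiffOn ℝ 1 h (cylinder τ)) {θ : Vel → ℝ} (hθ : MemLp θ ∞ volume)
    (hθi : ∀ i : Fin 3, MemLp (fun v : Vel => v i * θ v) ∞ volume) {p : ℝ × Pos}
    (hp : p ∈ cylinder τ) :
    fderivWithin ℝ (fun p => velQuad θ (h p)) (cylinder τ) p (1, 0)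
      + ∑ i, fderivWithin ℝ (fun p => velQuad (fun v => v i * θ v) (h p)) (cylinder τ) p
          (0, Pi.single i 1)
      = ∫ v, 2 * (θ v * (h p v * transport τ h p v)) := by
  rw [fderivWithin_velQuad hτ hh hθ hp]
  simp only [fun i => fderivWithin_velQuad hτ hh (hθi i) hp]
  rw [← Finset.mul_sum, ← mul_add, ← integral_finsetSum _ fun i _ => integrable_mul_mul (hθi i) _ _,
    ← integral_add (integrable_mul_mul hθ _ _)
      (integrable_finsetSum _ fun i _ => integrable_mul_mul (hθi i) _ _), ← integral_const_mul]
  refine integral_congr_ae (.of_forall fun v => ?_)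
  simp only [transport, Fin.sum_univ_three]
  ring

/-- The production is controlled by the `L¹₂` distance, through the Lipschitz estimate for the
Maxwellian, and by the residual; the damping `-h` absorbs both occurrences of `h`. -/
lemma ofReal_production_le {M : StructuralConstants} {c L τ : ℝ}
    (hLip : IsMaxwellianLipschitz M c L) (hτ : 0 < τ) {w : Vel → ℝ} (hw1 : ∀ v, 1 ≤ w v)
    (hint : Integrable (fun v : Vel => w v ^ 2 * Real.exp (-2 * c * ‖v‖ ^ 2)) volume)
    {f₀ : Pos → Vel → ℝ} {f g : ℝ × Pos → VSpace} (hf : AnsatzSpace M τ f)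
    (hg : AnsatzSpace M τ g) (hsol : IsBGKSolution τ f₀ f) {s : ℝ} (hs : s ∈ Ioo 0 τ) {x : Pos}
    (hx : ∀ i, x i ∈ Ioo (0 : ℝ) 1) (n : ℕ) :
    ENNReal.ofReal (∫ v, 2 * (truncSq w n v * ((f (s, x) - g (s, x)) v
        * transport τ (fun p => f p - g p) (s, x) v)))
      ≤ ENNReal.ofReal (L ^ 2 * (∫ v : Vel, w v ^ 2 * Real.exp (-2 * c * ‖v‖ ^ 2))
          * weightedDist (f (s, x)) (g (s, x)) ^ 2)
        + ∫⁻ v, ENNReal.ofReal ((w v * resPde τ g s x v) ^ 2) := by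
  have hp : (s, x) ∈ cylinder τ :=
    ⟨Ioo_subset_Icc_self hs, fun i => (hx i).1.le, fun i => (hx i).2.le⟩
  set a := weightedDist (f (s, x)) (g (s, x))
  refine (ofReal_integral_le_lintegral _).trans ?_
  have hpt : ∀ᵐ v, 2 * (truncSq w n v * ((f (s, x) - g (s, x)) v
        * transport τ (fun p => f p - g p) (s, x) v))
      ≤ (L * a) ^ 2 * (w v ^ 2 * Real.exp (-2 * c * ‖v‖ ^ 2)) + (w v * resPde τ g s x v) ^ 2 := by
    filter_upwards [transport_sub_ae hτ hf.contDiffOn hg.contDiffOn hp,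
      coeFn_sub (f (s, x)) (g (s, x)), hsol.equation s hs x hx] with v e1 e2 e3
    have hm : |localMaxwellian (f (s, x)) v - localMaxwellian (g (s, x)) v|
        ≤ L * Real.exp (-c * ‖v‖ ^ 2) * a := hLip τ hτ f g hf hg (s, x) hp v
    set m := localMaxwellian (f (s, x)) v - localMaxwellian (g (s, x)) v with hmdef
    set r := resPde τ g s x v with hr
    set k := (f (s, x) - g (s, x)) v
    have e4 : transport τ (fun p => f p - g p) (s, x) v = m - k - r := by
      rw [e1, e3, e2, hmdef, hr, resPde]; ring
    have hm2 : m ^ 2 ≤ (L * a) ^ 2 * Real.exp (-2 * c * ‖v‖ ^ 2) := by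
      calc m ^ 2 = |m| ^ 2 := (sq_abs m).symm
        _ ≤ (L * Real.exp (-c * ‖v‖ ^ 2) * a) ^ 2 := pow_le_pow_left₀ (abs_nonneg _) hm 2
        _ = (L * a) ^ 2 * Real.exp (-c * ‖v‖ ^ 2) ^ 2 := by ring
        _ = _ := by rw [← Real.exp_nat_mul]; push_cast; ring_nf
    have hθ0 := truncSq_nonneg w n v
    have hθ1 := truncSq_le_sq hw1 n v
    rw [e4]
    calc 2 * (truncSq w n v * (k * (m - k - r)))
        ≤ truncSq w n v * (m ^ 2 + r ^ 2) := by
          nlinarith [mul_nonneg hθ0 (sq_nonneg (k - m)), mul_nonneg hθ0 (sq_nonneg (k + r))]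
      _ ≤ w v ^ 2 * ((L * a) ^ 2 * Real.exp (-2 * c * ‖v‖ ^ 2) + r ^ 2) := by gcongr
      _ = _ := by ring
  have hmeas : AEMeasurable fun v : Vel => ENNReal.ofReal
      ((L * a) ^ 2 * (w v ^ 2 * Real.exp (-2 * c * ‖v‖ ^ 2))) :=
    (hint.aestronglyMeasurable.aemeasurable.const_mul _).ennreal_ofReal
  calc _ ≤ ∫⁻ v : Vel, (ENNReal.ofReal ((L * a) ^ 2 * (w v ^ 2 * Real.exp (-2 * c * ‖v‖ ^ 2)))
          + ENNReal.ofReal ((w v * resPde τ g s x v) ^ 2)) := by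
        refine lintegral_mono_ae (hpt.mono fun v hv => ?_)
        exact (ENNReal.ofReal_le_ofReal hv).trans ENNReal.ofReal_add_le
    _ = _ := by
        rw [lintegral_add_left' hmeas, ← ofReal_integral_eq_lintegral_ofReal (hint.const_mul _)
          (.of_forall fun v => by positivity), integral_const_mul]
        congr 2
        ring

/-! ### Boundary term -/

/-- An essential bound on the cylinder for a continuous function holds everywhere. -/
lemma le_of_ae_le_cylinder {τ : ℝ} (hτ : 0 < τ) {φ : ℝ × Pos → ℝ} {C : ℝ}
    (hφ : ContinuousOn φ (cylinder τ)) (h : ∀ᵐ p ∂(volume.restrict (cylinder τ)), φ p ≤ C)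
    {p : ℝ × Pos} (hp : p ∈ cylinder τ) : φ p ≤ C := by
  have hconv : Convex ℝ (cylinder τ) := (convex_Icc _ _).prod (convex_Icc _ _)
  have hint : (interior (cylinder τ)).Nonempty := by
    refine ⟨(τ / 2, fun _ => 1 / 2), ?_⟩
    rw [cylinder, interior_prod_eq, interior_Icc, ← pi_univ_Icc,
      interior_pi_set finite_univ]
    refine ⟨⟨by positivity, by simpa using half_lt_self hτ⟩, fun i _ => ?_⟩
    simp only [Pi.zero_apply, Pi.one_apply, interior_Icc]
    constructor <;> norm_num
  have hcl : cylinder τ ⊆ closure (interior (cylinder τ)) := by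
    rw [hconv.closure_interior_eq_closure_of_nonempty_interior hint]
    exact subset_closure
  -- `max φ C` and `C` are continuous and agree almost everywhere.
  have key := Measure.eqOn_of_ae_eq (μ := volume) (f := fun p => max (φ p) C) (g := fun _ => C)
    (h.mono fun q hq => max_eq_right hq) (hφ.sup continuousOn_const) continuousOn_const hcl hp
  exact max_eq_right_iff.1 key

lemma continuous_l2norm : Continuous l2norm := toL2.continuous.norm

lemma AnsatzSpace.l2norm_le' {M τ f} (hf : AnsatzSpace M τ f) (hτ : 0 < τ) {p}
    (hp : p ∈ cylinder τ) : l2norm (f p) ≤ M.Cinf :=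
  le_of_ae_le_cylinder hτ (continuous_l2norm.comp_continuousOn hf.contDiffOn.continuousOn)
    hf.l2norm_le hp

lemma l2norm_add_le (a b : VSpace) : l2norm (a + b) ≤ l2norm a + l2norm b :=
  norm_add_le a.1.2 b.1.2

lemma l2norm_sub_le (a b : VSpace) : l2norm (a - b) ≤ l2norm a + l2norm b :=
  norm_sub_le a.1.2 b.1.2

/-- The difference of squares `(f - g₁)² - (f - g₀)²` contains the factor `g₁ - g₀`; the other
factor is bounded in `L²`, so Cauchy–Schwarz applies. -/
lemma ofReal_abs_velQuad_sub_sq_le {w : Vel → ℝ} (hw : AEMeasurable w) (hw1 : ∀ v, 1 ≤ w v)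
    (n : ℕ) (i : Fin 3) {C : ℝ} {f g₁ g₀ : VSpace} (hf : l2norm f ≤ C) (hg₁ : l2norm g₁ ≤ C)
    (hg₀ : l2norm g₀ ≤ C) :
    ENNReal.ofReal |velQuad (fun v => v i * truncSq w n v) (f - g₁)
        - velQuad (fun v => v i * truncSq w n v) (f - g₀)| ^ 2
      ≤ ENNReal.ofReal ((4 * C) ^ 2)
        * ∫⁻ v : Vel, ENNReal.ofReal ((v i * w v ^ 2 * (g₁ v - g₀ v)) ^ 2) := by
  have hθ := memLp_coord_mul_truncSq hw hw1 n i
  rw [velQuad_sub_velQuad hθ, sub_sub_sub_cancel_left, mul_comm]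
  refine (ofReal_abs_integral_mul_mul_sq_le hθ (g₀ - g₁) (f - g₁ + (f - g₀))).trans
    (mul_le_mul' ?_ ?_)
  · refine lintegral_mono_ae ?_
    filter_upwards [coeFn_sub g₀ g₁] with v hv
    refine ENNReal.ofReal_le_ofReal ?_
    rw [hv, ← neg_sub (g₁ v), mul_neg, neg_sq, mul_pow, mul_pow, mul_pow (v i * w v ^ 2),
      mul_pow (v i)]
    have h0 := truncSq_nonneg w n v
    have h1 := truncSq_le_sq hw1 n v
    gcongr
  · refine ENNReal.ofReal_le_ofReal (pow_le_pow_left₀ (norm_nonneg _) ?_ 2)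
    change l2norm (f - g₁ + (f - g₀)) ≤ 4 * C
    have b3 := l2norm_add_le (f - g₁) (f - g₀)
    have b4 := l2norm_sub_le f g₁
    have b5 := l2norm_sub_le f g₀
    linarith

/-- On a pair of opposite faces the periodicity of the exact solution leaves one factor of the
difference of squares equal to the boundary residual; the other one is bounded by `4 C_∞`. -/
lemma ofReal_abs_velQuad_sub_sq_le_resBc {M : StructuralConstants} {τ : ℝ} (hτ : 0 < τ)
    {w : Vel → ℝ} (hw : AEMeasurable w) (hw1 : ∀ v, 1 ≤ w v) {f₀ : Pos → Vel → ℝ} {f g : ℝ × Pos → VSpace}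
    (hf : AnsatzSpace M τ f) (hg : AnsatzSpace M τ g) (hsol : IsBGKSolution τ f₀ f) (n : ℕ)
    (i : Fin 3) {s : ℝ} (hs : s ∈ Icc 0 τ) {y : Fin 2 → ℝ} (hy : y ∈ Icc (0 : Fin 2 → ℝ) 1) :
    ENNReal.ofReal |velQuad (fun v => v i * truncSq w n v)
          (f (s, i.insertNth 1 y) - g (s, i.insertNth 1 y))
        - velQuad (fun v => v i * truncSq w n v)
          (f (s, i.insertNth 0 y) - g (s, i.insertNth 0 y))| ^ 2
      ≤ ENNReal.ofReal ((4 * M.Cinf) ^ 2)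
        * ∫⁻ v : Vel, ENNReal.ofReal ((v i * w v ^ 2 * resBc g i s y v) ^ 2) := by
  have hp1 : (s, (i.insertNth 1 y : Pos)) ∈ cylinder τ :=
    ⟨hs, insertNth_mem_cube (right_mem_Icc.2 zero_le_one) hy⟩
  have hp0 : (s, (i.insertNth 0 y : Pos)) ∈ cylinder τ :=
    ⟨hs, insertNth_mem_cube (left_mem_Icc.2 zero_le_one) hy⟩
  rw [hsol.periodic s hs i y hy]
  exact ofReal_abs_velQuad_sub_sq_le hw hw1 n i (hf.l2norm_le' hτ hp0) (hg.l2norm_le' hτ hp1)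
    (hg.l2norm_le' hτ hp0)

lemma ofReal_abs_faceFlux_sq_le {M : StructuralConstants} {τ : ℝ} (hτ : 0 < τ) {w : Vel → ℝ}
    (hw : AEMeasurable w) (hw1 : ∀ v, 1 ≤ w v) {f₀ : Pos → Vel → ℝ} {f g : ℝ × Pos → VSpace}
    (hf : AnsatzSpace M τ f) (hg : AnsatzSpace M τ g) (hsol : IsBGKSolution τ f₀ f) (n : ℕ)
    (i : Fin 3) {s : ℝ} (hs : s ∈ Icc 0 τ) :
    ENNReal.ofReal |faceFlux (fun p => velQuad (fun v => v i * truncSq w n v)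
        (f p - g p)) i s| ^ 2
      ≤ ENNReal.ofReal ((4 * M.Cinf) ^ 2)
        * faceNormSq (fun y v => v i * w v ^ 2 * resBc g i s y v) := by
  have hc := (contDiffOn_velQuad (hf.contDiffOn.sub hg.contDiffOn)
    (memLp_coord_mul_truncSq hw hw1 n i)).continuousOn
  have hci : ∀ c ∈ Icc (0 : ℝ) 1, ContinuousOn (fun y : Fin 2 → ℝ =>
      velQuad (fun v => v i * truncSq w n v)
        (f (s, i.insertNth c y) - g (s, i.insertNth c y))) (Icc 0 1) := fun c hc' =>
    (continuousOn_face hc i hc').comp (f := fun y : Fin 2 → ℝ => (s, y))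
        (by fun_prop) fun y hy => ⟨hs, hy⟩
  have hm := (((hci 1 (right_mem_Icc.2 zero_le_one)).sub
    (hci 0 (left_mem_Icc.2 zero_le_one))).abs.aestronglyMeasurable (μ := volume)
      measurableSet_Icc).aemeasurable.ennreal_ofReal
  have h1 : (volume.restrict (Icc (0 : Fin 2 → ℝ) 1)) univ = 1 := by
    simp [Real.volume_Icc_pi]
  rw [faceNormSq, ← lintegral_const_mul' _ _ ENNReal.ofReal_ne_top]
  refine (pow_le_pow_left' ((ENNReal.ofReal_le_ofReal abs_integral_le_integral_abs).trans
    (ofReal_integral_le_lintegral _)) 2).trans ((sq_lintegral_le hm).trans ?_)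
  rw [h1, one_mul]
  exact setLIntegral_mono_ae' measurableSet_Icc (.of_forall fun y hy =>
    ofReal_abs_velQuad_sub_sq_le_resBc hτ hw hw1 hf hg hsol n i hs hy)

lemma lintegral_abs_faceFlux_le {M : StructuralConstants} {τ : ℝ} (hτ : 0 < τ) {w : Vel → ℝ}
    (hw : AEMeasurable w) (hw1 : ∀ v, 1 ≤ w v) {f₀ : Pos → Vel → ℝ} {f g : ℝ × Pos → VSpace}
    (hf : AnsatzSpace M τ f) (hg : AnsatzSpace M τ g) (hsol : IsBGKSolution τ f₀ f) (n : ℕ)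
    (i : Fin 3) {t : ℝ} (ht : t ∈ Icc 0 τ) :
    ∫⁻ s in Icc 0 t, ENNReal.ofReal |faceFlux (fun p =>
        velQuad (fun v => v i * truncSq w n v)
        (f p - g p)) i s|
      ≤ ENNReal.ofReal (4 * M.Cinf * Real.sqrt τ)
        * (∫⁻ s in Icc 0 t, faceNormSq (fun y v => v i * w v ^ 2 * resBc g i s y v))
          ^ (1 / 2 : ℝ) := by
  have hsub : Icc 0 t ⊆ Icc 0 τ := Icc_subset_Icc_right ht.2
  have hc := (contDiffOn_velQuad (hf.contDiffOn.sub hg.contDiffOn)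
    (memLp_coord_mul_truncSq hw hw1 n i)).continuousOn
  have hm := (((continuousOn_faceFlux hc i).mono hsub).abs.aestronglyMeasurable (μ := volume)
    measurableSet_Icc).aemeasurable.ennreal_ofReal
  have hC := M.Cinf_pos
  have h1 : (volume.restrict (Icc 0 t)) univ ≤ ENNReal.ofReal τ := by
    simpa using ENNReal.ofReal_le_ofReal ht.2
  set J := ∫⁻ s in Icc 0 t, faceNormSq (fun y v => v i * w v ^ 2 * resBc g i s y v)
  have h2 := (sq_lintegral_le hm).trans (mul_le_mul' h1
    (setLIntegral_mono_ae' measurableSet_Icc (.of_forall fun s hs =>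
      ofReal_abs_faceFlux_sq_le hτ hw hw1 hf hg hsol n i (hsub hs))))
  rw [lintegral_const_mul' _ _ ENNReal.ofReal_ne_top] at h2
  have h3 : (ENNReal.ofReal (4 * M.Cinf * Real.sqrt τ) * J ^ (1 / 2 : ℝ)) ^ 2
      = ENNReal.ofReal τ * (ENNReal.ofReal ((4 * M.Cinf) ^ 2) * J) := by
    rw [mul_pow, ← ENNReal.ofReal_pow (by positivity), mul_pow, Real.sq_sqrt hτ.le,
      ENNReal.ofReal_mul (by positivity), ← ENNReal.rpow_natCast (J ^ (1 / 2 : ℝ)),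
      ← ENNReal.rpow_mul]
    norm_num
    ring
  rw [← h3] at h2
  exact (ENNReal.pow_le_pow_left_iff two_ne_zero).1 h2

/-! ### Grönwall's inequality -/

lemma integral_le_of_le_add_mul_integral {A : ℝ → ℝ} {t α β : ℝ} (ht : 0 ≤ t)
    (hA : ContinuousOn A (Icc 0 t)) (hA0 : ∀ s ∈ Icc 0 t, 0 ≤ A s) (hβ : 0 < β)
    (h : ∀ s ∈ Icc 0 t, A s ≤ α + β * ∫ r in Icc 0 s, A r) :
    ∫ r in Icc 0 t, A r ≤ α / β * (Real.exp (β * t) - 1) := by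
  -- The continuous extension of `A` makes its primitive differentiable everywhere.
  set A' : ℝ → ℝ := IccExtend ht ((Icc 0 t).domRestrict A) with hA'
  have hc : Continuous A' := (continuousOn_iff_continuous_domRestrict.1 hA).Icc_extend'
  have hAA : ∀ s ∈ Icc 0 t, A' s = A s := fun s hs => by
    rw [hA', IccExtend_of_mem ht _ hs, domRestrict_apply]
  have hI : ∀ s ∈ Icc 0 t, ∫ r in Icc 0 s, A r = ∫ r in (0 : ℝ)..s, A' r := fun s hs => by
    rw [intervalIntegral.integral_of_le hs.1, ← integral_Icc_eq_integral_Ioc]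
    exact setIntegral_congr_fun measurableSet_Icc fun r hr =>
      (hAA r ⟨hr.1, hr.2.trans hs.2⟩).symm
  have hG0 : ∀ s ∈ Icc 0 t, 0 ≤ ∫ r in (0 : ℝ)..s, A' r := fun s hs => by
    rw [← hI s hs]
    exact setIntegral_nonneg measurableSet_Icc fun r hr => hA0 r ⟨hr.1, hr.2.trans hs.2⟩
  have hd : ∀ s, HasDerivAt (fun s => ∫ r in (0 : ℝ)..s, A' r) (A' s) s := fun s =>
    (hc.integral_hasStrictDerivAt 0 s).hasDerivAt
  have key := norm_le_gronwallBound_of_norm_deriv_right_le (f := fun s => ∫ r in (0 : ℝ)..s, A' r)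
    (f' := A') (δ := 0) (K := β) (ε := α) (a := 0) (b := t)
    (fun s _ => (hd s).continuousAt.continuousWithinAt) (fun s _ => (hd s).hasDerivWithinAt)
    (by simp) (fun s hs => by
      have hs' := Ico_subset_Icc_self hs
      rw [Real.norm_of_nonneg (hG0 s hs'), hAA s hs', Real.norm_of_nonneg (hA0 s hs'), ← hI s hs',
        add_comm]
      exact h s hs') t (right_mem_Icc.2 ht)
  rw [gronwallBound_of_K_ne_0 hβ.ne', Real.norm_of_nonneg (hG0 t (right_mem_Icc.2 ht)),
    ← hI t (right_mem_Icc.2 ht)] at key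
  simpa using key

/-- Grönwall's inequality for an energy `y` that may be infinite, whose growth is driven by a
continuous quantity `A ≤ K₁ y`: no finiteness of `y` is needed, as the argument runs on `A`. -/
lemma le_exp_mul_of_le_add_lintegral {y : ℝ → ℝ≥0∞} {A : ℝ → ℝ} {t K K₁ : ℝ} {E : ℝ≥0∞}
    (ht : 0 ≤ t) (hA : ContinuousOn A (Icc 0 t)) (hA0 : ∀ s ∈ Icc 0 t, 0 ≤ A s) (hK : 0 < K)
    (hK₁ : 0 < K₁) (hAy : ∀ s ∈ Icc 0 t, ENNReal.ofReal (A s) ≤ ENNReal.ofReal K₁ * y s)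
    (hy : ∀ s ∈ Icc 0 t,
      y s ≤ E + ENNReal.ofReal K * ∫⁻ r in Icc 0 s, ENNReal.ofReal (A r)) :
    y t ≤ ENNReal.ofReal (Real.exp (K * K₁ * t)) * E := by
  by_cases hE : E = ∞
  · rw [hE, ENNReal.mul_top (by simpa using Real.exp_pos _)]
    exact le_top
  obtain ⟨e, he, rfl⟩ : ∃ e : ℝ, 0 ≤ e ∧ E = ENNReal.ofReal e :=
    ⟨E.toReal, ENNReal.toReal_nonneg, (ENNReal.ofReal_toReal hE).symm⟩
  have hsub : ∀ s ∈ Icc 0 t, Icc 0 s ⊆ Icc 0 t := fun s hs => Icc_subset_Icc_right hs.2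
  have hI0 : ∀ s ∈ Icc 0 t, 0 ≤ ∫ r in Icc 0 s, A r := fun s hs =>
    setIntegral_nonneg measurableSet_Icc fun r hr => hA0 r (hsub s hs hr)
  have hy' : ∀ s ∈ Icc 0 t, y s ≤ ENNReal.ofReal (e + K * ∫ r in Icc 0 s, A r) := fun s hs => by
    rw [ENNReal.ofReal_add he (mul_nonneg hK.le (hI0 s hs)), ENNReal.ofReal_mul hK.le,
      ofReal_integral_eq_lintegral_ofReal ((hA.mono (hsub s hs)).integrableOn_compact isCompact_Icc)
        ((ae_restrict_mem measurableSet_Icc).mono fun r hr => hA0 r (hsub s hs hr))]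
    exact hy s hs
  have hG := integral_le_of_le_add_mul_integral (α := K₁ * e) (β := K * K₁) ht hA hA0
    (by positivity) fun s hs => by
      have h1 := (hAy s hs).trans (mul_le_mul_right (hy' s hs) _)
      have h2 := hI0 s hs
      rw [← ENNReal.ofReal_mul hK₁.le, ENNReal.ofReal_le_ofReal_iff (by positivity)] at h1
      linarith
  have htt := right_mem_Icc.2 ht
  refine (hy' t htt).trans ?_
  rw [← ENNReal.ofReal_mul (Real.exp_pos _).le]
  refine ENNReal.ofReal_le_ofReal ?_
  calc e + K * ∫ r in Icc 0 t, A r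
      ≤ e + K * (K₁ * e / (K * K₁) * (Real.exp (K * K₁ * t) - 1)) := by gcongr
    _ = Real.exp (K * K₁ * t) * e := by field_simp; ring

/-! ### Stability estimate -/

lemma normSq_congr {h k : Pos → Vel → ℝ}
    (hk : ∀ x ∈ Icc (0 : Pos) 1, ∀ᵐ v, h x v ^ 2 = k x v ^ 2) : normSq h = normSq k :=
  setLIntegral_congr_fun measurableSet_Icc fun x hx =>
    lintegral_congr_ae ((hk x hx).mono fun v hv => by simp only [hv])

/-- Pointwise bounds of `D` inside the cylinder, by a quantity continuous in space and time and by
one that need not be measurable, carry over to the integrals. -/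
lemma lintegral_cylinder_le {τ : ℝ} {D a : ℝ × Pos → ℝ} {R : ℝ → Pos → ℝ≥0∞} {κ : ℝ} (hκ : 0 ≤ κ)
    (ha : ContinuousOn a (cylinder τ)) (ha0 : ∀ p, 0 ≤ a p)
    (hD : ∀ s ∈ Ioo 0 τ, ∀ x : Pos, (∀ i, x i ∈ Ioo (0 : ℝ) 1) →
      ENNReal.ofReal (D (s, x)) ≤ ENNReal.ofReal (κ * a (s, x)) + R s x)
    {t : ℝ} (ht : t ∈ Icc 0 τ) :
    ∫⁻ s in Icc 0 t, ∫⁻ x in Icc (0 : Pos) 1, ENNReal.ofReal (D (s, x))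
      ≤ ENNReal.ofReal κ * (∫⁻ s in Icc 0 t, ENNReal.ofReal (∫ x in Icc (0 : Pos) 1, a (s, x)))
        + ∫⁻ s in Icc 0 t, ∫⁻ x in Icc (0 : Pos) 1, R s x := by
  have hsub : Icc 0 t ⊆ Icc 0 τ := Icc_subset_Icc_right ht.2
  have hcube : ∀ᵐ x ∂(volume : Measure Pos).restrict (Icc 0 1), ∀ i, x i ∈ Ioo (0 : ℝ) 1 := by
    have h := Measure.univ_pi_Ioo_ae_eq_Icc (μ := fun _ : Fin 3 => (volume : Measure ℝ))
      (f := (0 : Pos)) (g := 1)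
    rw [← volume_pi] at h
    rw [← Measure.restrict_congr_set h]
    filter_upwards [ae_restrict_mem (MeasurableSet.univ_pi fun _ => measurableSet_Ioo)] with x hx i
    exact hx i trivial
  have hpt : ∀ s ∈ Ioo 0 t, ∫⁻ x in Icc (0 : Pos) 1, ENNReal.ofReal (D (s, x))
      ≤ ENNReal.ofReal κ * ENNReal.ofReal (∫ x in Icc (0 : Pos) 1, a (s, x))
        + ∫⁻ x in Icc (0 : Pos) 1, R s x := fun s hs => by
    have hc := continuousOn_slice ha (hsub (Ioo_subset_Icc_self hs))
    have hm := (hc.aestronglyMeasurable (μ := volume)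
      measurableSet_Icc).aemeasurable.const_mul κ |>.ennreal_ofReal
    refine (lintegral_mono_ae (hcube.mono fun x hx => hD s ⟨hs.1, hs.2.trans_le ht.2⟩ x hx)).trans
      ?_
    rw [lintegral_add_left' hm, ofReal_integral_eq_lintegral_ofReal
      (hc.integrableOn_compact isCompact_cube) (.of_forall fun x => ha0 _),
      ← lintegral_const_mul' _ _ ENNReal.ofReal_ne_top]
    simp only [ENNReal.ofReal_mul hκ]
    exact le_rfl
  have hm : AEMeasurable (fun s => ENNReal.ofReal κ
      * ENNReal.ofReal (∫ x in Icc (0 : Pos) 1, a (s, x))) (volume.restrict (Icc 0 t)) :=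
    ((((continuousOn_setIntegral isCompact_cube measurableSet_Icc ha).mono
      hsub).aestronglyMeasurable measurableSet_Icc).aemeasurable.ennreal_ofReal).const_mul _
  rw [← lintegral_const_mul' _ _ ENNReal.ofReal_ne_top, ← lintegral_add_left' hm]
  refine lintegral_mono_ae ?_
  rw [← Measure.restrict_congr_set (Ioo_ae_eq_Icc (a := 0) (b := t))]
  exact (ae_restrict_mem measurableSet_Ioo).mono hpt

/-- The squared `L¹₂` distance is continuous in space and time. -/
lemma continuousOn_weightedDist_sq {M : StructuralConstants} {τ : ℝ} {f g : ℝ × Pos → VSpace}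
    (hf : AnsatzSpace M τ f) (hg : AnsatzSpace M τ g) :
    ContinuousOn (fun p => weightedDist (f p) (g p) ^ 2) (cylinder τ) := by
  have h1 : ContinuousOn (fun p => f p - g p) (cylinder τ) :=
    hf.contDiffOn.continuousOn.sub hg.contDiffOn.continuousOn
  have h2 : ContinuousOn (fun p => ‖toL1 (f p - g p)‖) (cylinder τ) :=
    (toL1.continuous.comp_continuousOn h1).norm
  refine (h2.congr fun p _ => ?_).pow 2
  exact (norm_fst_sub_eq (f p) (g p)).symm

/-- The energy inequality: the weighted norm at time `s` is controlled by the data up to a later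
time `t` and by the `L¹₂` distance up to time `s`. -/
lemma normSq_le_add_lintegral {M : StructuralConstants} {c L τ : ℝ}
    (hLip : IsMaxwellianLipschitz M c L) (hτ : 0 < τ) {w : Vel → ℝ} (hw1 : ∀ v, 1 ≤ w v)
    (hint : Integrable (fun v : Vel => w v ^ 2 * Real.exp (-2 * c * ‖v‖ ^ 2)) volume)
    {f₀ : Pos → Vel → ℝ} {f g : ℝ × Pos → VSpace} (hf : AnsatzSpace M τ f)
    (hg : AnsatzSpace M τ g) (hsol : IsBGKSolution τ f₀ f) {t : ℝ} (ht : t ∈ Icc 0 τ) :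
    normSq (fun x v => w v * (f (t, x) v - g (t, x) v))
      ≤ normSq (fun x v => w v * resIni f₀ g x v)
        + (∫⁻ s in Icc 0 t, normSq (fun x v => w v * resPde τ g s x v))
        + (∑ i : Fin 3, ENNReal.ofReal (4 * M.Cinf * Real.sqrt τ)
            * (∫⁻ s in Icc 0 t, faceNormSq (fun y v => v i * w v ^ 2 * resBc g i s y v))
              ^ (1 / 2 : ℝ))
        + ENNReal.ofReal (L ^ 2 * ∫ v : Vel, w v ^ 2 * Real.exp (-2 * c * ‖v‖ ^ 2))
          * ∫⁻ s in Icc 0 t,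
            ENNReal.ofReal (∫ x in Icc (0 : Pos) 1, weightedDist (f (s, x)) (g (s, x)) ^ 2) := by
  have hw := aemeasurable_of_integrable_sq_mul_exp hw1 hint
  have hh : ContDiffOn ℝ 1 (fun p => f p - g p) (cylinder τ) := hf.contDiffOn.sub hg.contDiffOn
  have hκ : 0 ≤ L ^ 2 * ∫ v : Vel, w v ^ 2 * Real.exp (-2 * c * ‖v‖ ^ 2) :=
    mul_nonneg (sq_nonneg L) (integral_nonneg fun v => by positivity)
  have h0 : (0 : ℝ) ∈ Icc 0 τ := ⟨le_rfl, hτ.le⟩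
  have hdiff : ∀ s, normSq (fun x v => w v * (f (s, x) v - g (s, x) v))
      = normSq (fun x v => w v * (f (s, x) - g (s, x)) v) := fun s =>
    normSq_congr fun x _ => by
      filter_upwards [coeFn_sub (f (s, x)) (g (s, x))] with v hv
      rw [hv]
  have hini : normSq (fun x v => w v * (f (0, x) - g (0, x)) v)
      = normSq (fun x v => w v * resIni f₀ g x v) := by
    rw [← hdiff]
    refine normSq_congr fun x hx => ?_
    filter_upwards [hsol.initial x hx] with v hv
    rw [hv, resIni]
    ring
  rw [hdiff]
  refine normSq_le_of_forall_truncSq hw hw1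
    (continuousOn_slice hh.continuousOn ht) fun n => ?_
  have hbal := ofReal_setIntegral_le_of_balance hτ
    (contDiffOn_velQuad hh (memLp_truncSq hw hw1 n))
    (fun i => contDiffOn_velQuad hh (memLp_coord_mul_truncSq hw hw1 n i))
    (D := fun p => ∫ v, 2 * (truncSq w n v * ((f p - g p) v
        * transport τ (fun p => f p - g p) p v)))
    (fun p hp => (fderivWithin_velQuad_add_sum hτ hh (memLp_truncSq hw hw1 n)
      (memLp_coord_mul_truncSq hw hw1 n) hp).symm) ht
  have hprod := lintegral_cylinder_le hκ (continuousOn_weightedDist_sq hf hg)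
    (fun p => sq_nonneg (weightedDist (f p) (g p)))
    (D := fun p => ∫ v, 2 * (truncSq w n v * ((f p - g p) v
        * transport τ (fun p => f p - g p) p v)))
    (R := fun s x => ∫⁻ v, ENNReal.ofReal ((w v * resPde τ g s x v) ^ 2))
    (fun s hs x hx => ofReal_production_le hLip hτ hw1 hint hf hg hsol hs hx n) ht
  have hzero : ENNReal.ofReal (∫ x in Icc (0 : Pos) 1, velQuad (truncSq w n) (f (0, x) - g (0, x)))
      ≤ normSq (fun x v => w v * resIni f₀ g x v) := by
    rw [← hini]
    exact (ofReal_integral_le_lintegral _).trans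
      (lintegral_mono fun x => ofReal_velQuad_truncSq_le hw hw1 n _)
  refine hbal.trans ((add_le_add (add_le_add hzero hprod) (Finset.sum_le_sum fun i _ =>
    lintegral_abs_faceFlux_le hτ hw hw1 hf hg hsol n i ht)).trans_eq ?_)
  simp only [normSq]
  ring

/-- The `L¹₂` distance, squared and integrated in space, is controlled by the weighted norm. -/
lemma ofReal_integral_weightedDist_sq_le {w : Vel → ℝ}
    (hw : AEMeasurable w) (hw1 : ∀ v, 1 ≤ w v)
    (hint : Integrable (fun v : Vel => (1 + ‖v‖ ^ 2) ^ 2 / w v ^ 2) volume)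
    {f g : ℝ × Pos → VSpace} (s : ℝ) :
    ENNReal.ofReal (∫ x in Icc (0 : Pos) 1, weightedDist (f (s, x)) (g (s, x)) ^ 2)
      ≤ ENNReal.ofReal (∫ v : Vel, (1 + ‖v‖ ^ 2) ^ 2 / w v ^ 2)
        * normSq (fun x v => w v * (f (s, x) v - g (s, x) v)) := by
  rw [normSq, ← lintegral_const_mul' _ _ ENNReal.ofReal_ne_top]
  exact (ofReal_integral_le_lintegral _).trans
    (lintegral_mono fun x => ofReal_weightedDist_sq_le hw hw1 hint _ _)

theorem exists_stability_constant {M : StructuralConstants} {c L : ℝ}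
    (hLip : IsMaxwellianLipschitz M c L) {τ : ℝ} {w : Vel → ℝ} (hτ : 0 < τ) (hw1 : ∀ v, 1 ≤ w v)
    (hint₁ : Integrable (fun v : Vel => (1 + ‖v‖ ^ 2) ^ 2 / w v ^ 2) volume)
    (hint₂ : Integrable (fun v : Vel => w v ^ 2 * Real.exp (-2 * c * ‖v‖ ^ 2)) volume) :
    ∃ C : ℝ, 0 < C ∧ ∀ (f₀ : Pos → Vel → ℝ) (f g : ℝ × Pos → VSpace),
      AnsatzSpace M τ f → AnsatzSpace M τ g → IsBGKSolution τ f₀ f → ∀ t ∈ Icc 0 τ,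
        normSq (fun x v => w v * (f (t, x) v - g (t, x) v)) ≤
          ENNReal.ofReal C *
            (normSq (fun x v => w v * resIni f₀ g x v)
              + (∫⁻ s in Icc 0 t, normSq (fun x v => w v * resPde τ g s x v))
              + ∑ i : Fin 3,
                  (∫⁻ s in Icc 0 t, faceNormSq (fun y v => v i * w v ^ 2 * resBc g i s y v))
                    ^ (1 / 2 : ℝ)) := by
  have hw := aemeasurable_of_integrable_sq_mul_exp hw1 hint₂
  set J₁ := ∫ v : Vel, (1 + ‖v‖ ^ 2) ^ 2 / w v ^ 2 with hJ₁
  set J₂ := L ^ 2 * ∫ v : Vel, w v ^ 2 * Real.exp (-2 * c * ‖v‖ ^ 2) with hJ₂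
  set b := 4 * M.Cinf * Real.sqrt τ
  have hJ₁0 : 0 ≤ J₁ := integral_nonneg fun v => by positivity
  have hJ₂0 : 0 ≤ J₂ := mul_nonneg (sq_nonneg L) (integral_nonneg fun v => by positivity)
  -- Both constants are increased by one so that they are visibly positive.
  have hK₁ : 0 < 1 + J₁ := by positivity
  have hK : 0 < 1 + J₂ := by positivity
  refine ⟨Real.exp ((1 + J₂) * (1 + J₁) * τ) * max 1 b,
    mul_pos (Real.exp_pos _) (zero_lt_one.trans_le (le_max_left _ _)), ?_⟩
  intro f₀ f g hf hg hsol t ht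
  have hc : ContinuousOn
      (fun s => ∫ x in Icc (0 : Pos) 1, weightedDist (f (s, x)) (g (s, x)) ^ 2) (Icc 0 t) :=
    (continuousOn_setIntegral isCompact_cube measurableSet_Icc
      (continuousOn_weightedDist_sq hf hg)).mono (Icc_subset_Icc_right ht.2)
  set ini := normSq (fun x v => w v * resIni f₀ g x v)
  have hgron := le_exp_mul_of_le_add_lintegral ht.1 hc
    (y := fun s => normSq (fun x v => w v * (f (s, x) v - g (s, x) v)))
    (E := ini + (∫⁻ s in Icc 0 t, normSq (fun x v => w v * resPde τ g s x v))
      + ∑ i : Fin 3, ENNReal.ofReal b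
          * (∫⁻ s in Icc 0 t, faceNormSq (fun y v => v i * w v ^ 2 * resBc g i s y v))
            ^ (1 / 2 : ℝ))
    (fun s _ => integral_nonneg fun x => sq_nonneg _) hK hK₁ ?_ ?_
  · refine hgron.trans ?_
    rw [ENNReal.ofReal_mul (Real.exp_pos _).le, mul_assoc (ENNReal.ofReal _)]
    refine mul_le_mul' (ENNReal.ofReal_le_ofReal (Real.exp_le_exp.2
      (mul_le_mul_of_nonneg_left ht.2 (by positivity)))) ?_
    have h1 : 1 ≤ ENNReal.ofReal (max 1 b) := by
      rw [← ENNReal.ofReal_one]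
      exact ENNReal.ofReal_le_ofReal (le_max_left _ _)
    rw [← Finset.mul_sum, mul_add]
    exact add_le_add (le_mul_of_one_le_left' h1)
      (mul_le_mul_left (ENNReal.ofReal_le_ofReal (le_max_right _ _)) _)
  · intro s _
    refine (ofReal_integral_weightedDist_sq_le hw hw1 hint₁ s).trans (mul_le_mul_left ?_ _)
    exact ENNReal.ofReal_le_ofReal (by linarith)
  · intro s hs
    have hsub : Icc 0 s ⊆ Icc 0 t := Icc_subset_Icc_right hs.2
    refine (normSq_le_add_lintegral hLip hτ hw1 hint₂ hf hg hsol
      ⟨hs.1, hs.2.trans ht.2⟩).trans ?_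
    gcongr
    exact le_add_of_nonneg_left zero_le_one

end BGK

theorem mainTheorem1 (M : BGK.StructuralConstants) :
    (∃ c L : ℝ, 0 < c ∧ 0 < L ∧ BGK.IsMaxwellianLipschitz M c L) ∧
    ∀ c L : ℝ, 0 < c → 0 < L → BGK.IsMaxwellianLipschitz M c L →
      ∀ (τ : ℝ) (w : BGK.Vel → ℝ), 0 < τ → (∀ v, 1 ≤ w v) →
        Integrable (fun v : BGK.Vel => (1 + ‖v‖ ^ 2) ^ 2 / w v ^ 2) volume →
        Integrable (fun v : BGK.Vel => w v ^ 2 * Real.exp (-2 * c * ‖v‖ ^ 2)) volume →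
        ∃ C : ℝ, 0 < C ∧
          ∀ (f₀ : BGK.Pos → BGK.Vel → ℝ) (f g : ℝ × BGK.Pos → BGK.VSpace),
            BGK.AnsatzSpace M τ f → BGK.AnsatzSpace M τ g → BGK.IsBGKSolution τ f₀ f →
            ∀ t ∈ Icc 0 τ,
              BGK.normSq (fun x v => w v * (f (t, x) v - g (t, x) v)) ≤
                ENNReal.ofReal C *
                  (BGK.normSq (fun x v => w v * BGK.resIni f₀ g x v)
                    + (∫⁻ s in Icc 0 t, BGK.normSq (fun x v => w v * BGK.resPde τ g s x v))
                    + ∑ i : Fin 3,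
                        (∫⁻ s in Icc 0 t,
                          BGK.faceNormSq (fun y v => v i * w v ^ 2 * BGK.resBc g i s y v))
                          ^ (1 / 2 : ℝ)) := by
  refine ⟨BGK.exists_isMaxwellianLipschitz M, fun c L _ _ hLip τ w hτ hw1 hint₁ hint₂ => ?_⟩
  exact BGK.exists_stability_constant hLip hτ hw1 hint₁ hint₂
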